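/- Let $U=(V,E)$ be a finite simple connected graph containing exactly one cycle (a unicyclic graph), let $u:V\to\mathbb{Q}_{\ge 0}$ be a utility function, extended to subsets of $V$ by $u(S)=\sum_{v\in S}u(v)$, and let $n\ge 1$ be an integer. A \emph{bundle} is a (possibly empty) subset of $V$ that induces a connected subgraph of $U$. An \emph{$n$-split} of $U$ is a sequence $P_1,\dots,P_n$ of pairwise disjoint bundles with $\bigcup_{i} P_i=V$. The \emph{maximin share} is $$\mathit{mms}^{(n)}(U,u)=\max_{P_1,\dots,P_n}\ \min_{1\le i\le n}u(P_i),$$ where the maximum is over all $n$-splits of $U$; an \emph{mms-split} is an $n$-split that attains this maximum. \textbf{Theorem.} There is a polynomial-time algorithm that, given a unicyclic graph $U$, a utility function $u:V(U)\to\mathbb{Q}_{\ge 0}$ and an integer $n\ge 1$, computes $\mathit{mms}^{(n)}(U,u)$ and an mms-split of $U$ for $u$ and $n$. Here $V=\{0,\dots,m-1\}$, the graph is given by its adjacency matrix, the utilities are given as fractions of integers, and all integers (including $n$) are written in binary; the running time is the logarithmic cost on a random access machine, bounded by a polynomial in the total bit length of the input; the value $\mathit{mms}^{(n)}(U,u)$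 is returned as a fraction of integers, and the split is returned by giving, for each good, the index of its bundle. -/

import Mathlib

/-! ## Splits of graphs of goods and the maximin share -/

namespace MMS

/-- A graph is unicyclic if it is connected and contains exactly one cycle. A cycle, as a subgraph,
is identified with the set of edges of a closed walk running through it. -/
def IsUnicyclic {V : Type*} (G : SimpleGraph V) : Prop :=
  G.Connected ∧
    ∃! C : Set (Sym2 V), ∃ (v : V) (w : G.Walk v v), w.IsCycle ∧ {e | e ∈ w.edges} = C

/-- A bundle is a set of goods inducing a connected subgraph; the empty set is a bundle. -/
def IsBundle {V : Type*} (G : SimpleGraph V) (S : Finset V) : Prop :=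
  (G.induce (S : Set V)).Preconnected

/-- An `n`-split: a sequence of `n` pairwise disjoint (possibly empty) bundles covering all goods. -/
def IsSplit {V : Type*} (G : SimpleGraph V) {n : ℕ} (P : Fin n → Finset V) : Prop :=
  (∀ i, IsBundle G (P i)) ∧ (∀ i j, i ≠ j → Disjoint (P i) (P j)) ∧ ∀ v, ∃ i, v ∈ P i

/-- The additive extension of a utility function to sets of goods. -/
def value {V : Type*} (u : V → ℝ) (S : Finset V) : ℝ := ∑ v ∈ S, u v

/-- `q` is the maximin share of `G`, `u` and `n`: the largest non-negative real number such that
some `n`-split of `G` has all its bundles of value at least that number. -/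
def IsMaximinShare {V : Type*} (G : SimpleGraph V) (u : V → ℝ) (n : ℕ) (q : ℝ) : Prop :=
  IsGreatest {r : ℝ | 0 ≤ r ∧ ∃ P : Fin n → Finset V, IsSplit G P ∧ ∀ i, r ≤ value u (P i)} q

/-- An mms-split: a split for which the smallest value of a bundle equals the maximin share. -/
def IsMaximinShareSplit {V : Type*} (G : SimpleGraph V) (u : V → ℝ) {n : ℕ}
    (P : Fin n → Finset V) : Prop :=
  IsSplit G P ∧ ∃ q, IsMaximinShare G u n q ∧ IsLeast (Set.range fun i => value u (P i)) q

end MMS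

/-! ## Random access machines with logarithmic cost

Programs are structured programs over a memory of natural numbers. The memory consists of arrays
numbered `0, 1, 2, …` (a program refers to finitely many of them), each with cells numbered
`0, 1, 2, …`; cell `0` of an array serves as an ordinary variable. Every operation is charged the
number of bits of the numbers that it handles. -/

namespace RAM

/-- A memory state: `s a i` is the content of cell `i` of array `a`. -/
abbrev State := ℕ → ℕ → ℕ

/-- Arithmetic expressions; `get a e` is the content of the cell of array `a` with index `e`. -/
inductive Expr : Type
  | const (k : ℕ)
  | get (a : ℕ) (e : Expr)
  | add (e f : Expr)
  | sub (e f : Expr)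
  | mul (e f : Expr)
  | div (e f : Expr)

/-- The value of an expression (truncated subtraction, integer division, `x / 0 = 0`). -/
def Expr.eval (s : State) : Expr → ℕ
  | const k => k
  | get a e => s a (e.eval s)
  | add e f => e.eval s + f.eval s
  | sub e f => e.eval s - f.eval s
  | mul e f => e.eval s * f.eval s
  | div e f => e.eval s / f.eval s

/-- The cost of evaluating an expression: every operation (including constants and memory accesses)
costs one plus the number of bits of its result, besides the cost of its arguments. -/
def Expr.cost (s : State) : Expr → ℕ
  | const k => 1 + Nat.size k
  | get a e => 1 + Nat.size (s a (e.eval s)) + e.cost s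
  | add e f => 1 + Nat.size (e.eval s + f.eval s) + e.cost s + f.cost s
  | sub e f => 1 + Nat.size (e.eval s - f.eval s) + e.cost s + f.cost s
  | mul e f => 1 + Nat.size (e.eval s * f.eval s) + e.cost s + f.cost s
  | div e f => 1 + Nat.size (e.eval s / f.eval s) + e.cost s + f.cost s

/-- Programs. `set a i e` stores the value of `e` in the cell of array `a` with index `i`; a test
`e` succeeds if the value of `e` is not zero. -/
inductive Prog : Type
  | skip
  | set (a : ℕ) (i e : Expr)
  | seq (c d : Prog)
  | cond (e : Expr) (c d : Prog)
  | loop (e : Expr) (c : Prog)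

/-- The state after storing `x` in cell `i` of array `a`. -/
def State.write (s : State) (a i x : ℕ) : State :=
  Function.update s a (Function.update (s a) i x)

/-- `Exec c s t r`: the program `c`, started in state `s`, halts in state `r` at total cost `t`. -/
inductive Exec : Prog → State → ℕ → State → Prop
  | skip (s : State) : Exec .skip s 1 s
  | set (s : State) (a : ℕ) (i e : Expr) :
      Exec (.set a i e) s (1 + i.cost s + e.cost s) (s.write a (i.eval s) (e.eval s))
  | seq {c d : Prog} {s r q : State} {t k : ℕ} (hc : Exec c s t r) (hd : Exec d r k q) :
      Exec (.seq c d) s (t + k) q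
  | cond_true {e : Expr} {c d : Prog} {s r : State} {t : ℕ} (he : e.eval s ≠ 0)
      (hc : Exec c s t r) : Exec (.cond e c d) s (1 + e.cost s + t) r
  | cond_false {e : Expr} {c d : Prog} {s r : State} {t : ℕ} (he : e.eval s = 0)
      (hd : Exec d s t r) : Exec (.cond e c d) s (1 + e.cost s + t) r
  | loop_true {e : Expr} {c : Prog} {s r q : State} {t k : ℕ} (he : e.eval s ≠ 0)
      (hc : Exec c s t r) (hl : Exec (.loop e c) r k q) :
      Exec (.loop e c) s (1 + e.cost s + t + k) q
  | loop_false {e : Expr} {c : Prog} {s : State} (he : e.eval s = 0) :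
      Exec (.loop e c) s (1 + e.cost s) s

/-- Programs are deterministic: the final state and the cost are determined by the initial state. -/
theorem Exec.deterministic {c : Prog} {s r : State} {t : ℕ} (h : Exec c s t r) :
    ∀ {k : ℕ} {q : State}, Exec c s k q → t = k ∧ r = q := by
  induction h with
  | skip s => intro k q h; cases h; exact ⟨rfl, rfl⟩
  | set s a i e => intro k q h; cases h; exact ⟨rfl, rfl⟩
  | seq _ _ ihc ihd =>
    intro k q h
    cases h with
    | seq h1 h2 =>
      obtain ⟨rfl, rfl⟩ := ihc h1
      obtain ⟨rfl, rfl⟩ := ihd h2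
      exact ⟨rfl, rfl⟩
  | cond_true he _ ih =>
    intro k q h
    cases h with
    | cond_true _ h1 => obtain ⟨rfl, rfl⟩ := ih h1; exact ⟨rfl, rfl⟩
    | cond_false h0 _ => exact absurd h0 he
  | cond_false he _ ih =>
    intro k q h
    cases h with
    | cond_true h0 _ => exact absurd he h0
    | cond_false _ h1 => obtain ⟨rfl, rfl⟩ := ih h1; exact ⟨rfl, rfl⟩
  | loop_true he _ _ ihc ihl =>
    intro k q h
    cases h with
    | loop_true _ h1 h2 =>
      obtain ⟨rfl, rfl⟩ := ihc h1
      obtain ⟨rfl, rfl⟩ := ihl h2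
      exact ⟨rfl, rfl⟩
    | loop_false h0 => exact absurd h0 he
  | loop_false he =>
    intro k q h
    cases h with
    | loop_true h0 _ _ => exact absurd he h0
    | loop_false _ => exact ⟨rfl, rfl⟩

/-- The initial state on an input list: array `0` holds the length of the list in cell `0` and its
entries in the cells `1, 2, …`; everything else is zero. -/
def input (l : List ℕ) : State := fun a i =>
  if a = 0 then (l.length :: l).getD i 0 else 0

/-- The output list of a final state: array `1` holds the length of the list in cell `0` and its
entries in the cells `1, 2, …`. -/
def output (s : State) : List ℕ := (List.range (s 1 0)).map fun i => s 1 (i + 1)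

/-- The size of an input list: the total number of bits of its entries, plus one per entry. -/
def inputSize (l : List ℕ) : ℕ := (l.map fun x => 1 + Nat.size x).sum

end RAM

namespace MMS

open Classical in
/-- The input list of an instance with goods `0, …, m - 1`: the numbers `m` and `n`, the numerators
and then the denominators of the utilities, and the adjacency matrix of the graph, row by row. -/
noncomputable def encode (m n : ℕ) (G : SimpleGraph (Fin m)) (num den : Fin m → ℕ) : List ℕ :=
  m :: n :: (List.ofFn num ++ List.ofFn den ++
    (List.finRange m).flatMap fun v => (List.finRange m).map fun w => if G.Adj v w then 1 else 0)

end MMS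

/-!
Multiplying all utilities by a common denominator `D` makes them integers, so that the maximin share
is `q / D` for the largest integer `q` such that some split has all its bundles of value at least
`q`. This `q` is found by binary search; what has to be decided is whether a threshold `q ≥ 1` is
met by some split.

*Reduction to trees* (`IsGood.exists_packable`). Every split of a unicyclic graph is a split of the
tree obtained by deleting a suitable edge of the cycle: one joining two bundles, if the cycle meets
two bundles, and any edge of the cycle otherwise. Conversely the splits of a subgraph are splits of the graph.
So it suffices to try the deletion of each edge in turn; deletions that do not leave a tree do no
harm, since a split is only accepted if it has been found.

*Trees* (`Cfg.strip`). Every vertex starts as a group of its own. As long as there are two groups,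
some group is a leaf of the tree of the groups. If its value is at least `q` and more than one
bundle is still to be formed, it becomes a bundle; otherwise it is merged into its neighbour.
`Sound.strip` says that the groups and bundles remain connected. `Packs.strip` says that nothing is
lost: if the tree contains `k` disjoint connected sets of value at least `q`, then what remains
contains `k - 1` or `k` such sets respectively. Disjoint sets that need not cover the tree are used
here, so that the set containing a leaf that becomes a bundle can simply be forgotten. When a single
group is left, a single set can be packed, so that the group is the last bundle (`Packs.final`).

*Running time.* In the program every product has a cell of the input as a factor, and the input is
never overwritten. Hence each elementary step lengthens the numbers in memory by at most a constant
times the length of the input, and the logarithmic cost is polynomial in the number of steps and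
the length of the input (`Steps.exec`). The number of steps is polynomial because the loops run over
vertices or over entries of the adjacency matrix, except for the binary search, whose number of
iterations is at most the bit length of the initial upper bound (`Wp` and its rules keep count).
-/

/-! ### Unit-cost runs and tame programs -/

namespace RAM

/-- `Steps c s n r`: the program `c`, started in state `s`, halts in state `r` after `n` elementary
steps, each assignment and each test counting as one step. -/
inductive Steps : Prog → State → ℕ → State → Prop
  | skip (s : State) : Steps .skip s 1 s
  | set (s : State) (a : ℕ) (i e : Expr) :
      Steps (.set a i e) s 1 (s.write a (i.eval s) (e.eval s))
  | seq {c d : Prog} {s r q : State} {t k : ℕ} (hc : Steps c s t r) (hd : Steps d r k q) :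
      Steps (.seq c d) s (t + k) q
  | cond_true {e : Expr} {c d : Prog} {s r : State} {t : ℕ} (he : e.eval s ≠ 0)
      (hc : Steps c s t r) : Steps (.cond e c d) s (1 + t) r
  | cond_false {e : Expr} {c d : Prog} {s r : State} {t : ℕ} (he : e.eval s = 0)
      (hd : Steps d s t r) : Steps (.cond e c d) s (1 + t) r
  | loop_true {e : Expr} {c : Prog} {s r q : State} {t k : ℕ} (he : e.eval s ≠ 0)
      (hc : Steps c s t r) (hl : Steps (.loop e c) r k q) : Steps (.loop e c) s (1 + t + k) q
  | loop_false {e : Expr} {c : Prog} {s : State} (he : e.eval s = 0) : Steps (.loop e c) s 1 s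

/-- Whether an expression is a cell of the input array. -/
def Expr.isInput : Expr → Bool
  | get 0 _ => true
  | _ => false

/-- An expression is tame if every product in it has a cell of the input array as its right
factor. The bit length of its value then exceeds those of the cells of the memory by no more than
a constant multiple of the bit length of the input. -/
def Expr.tame : Expr → Bool
  | const _ => true
  | get _ e => e.tame
  | add e f => e.tame && f.tame
  | sub e f => e.tame && f.tame
  | mul e f => e.tame && f.tame && f.isInput
  | div e f => e.tame && f.tame

/-- A program is tame if its expressions are and it never writes to the input array. -/
def Prog.tame : Prog → Bool
  | skip => true
  | set a i e => a != 0 && i.tame && e.tame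
  | seq c d => c.tame && d.tame
  | cond e c d => e.tame && c.tame && d.tame
  | loop e c => e.tame && c.tame

/-- A constant governing the growth and the cost of an expression. -/
def Expr.weight : Expr → ℕ
  | const k => 1 + Nat.size k
  | get _ e => 1 + e.weight
  | add e f => 1 + e.weight + f.weight
  | sub e f => 1 + e.weight + f.weight
  | mul e f => 1 + e.weight + f.weight
  | div e f => 1 + e.weight + f.weight

/-- A constant governing the growth and the cost of each step of a program. -/
def Prog.weight : Prog → ℕ
  | skip => 1
  | set _ i e => 1 + i.weight + e.weight
  | seq c d => c.weight + d.weight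
  | cond e c d => 1 + e.weight + c.weight + d.weight
  | loop e c => 1 + e.weight + c.weight

theorem size_add_le_of_le {x y b : ℕ} (hx : Nat.size x ≤ b) (hy : Nat.size y ≤ b) :
    Nat.size (x + y) ≤ b + 1 := by
  rw [Nat.size_le] at *
  rw [pow_succ]
  omega

theorem size_mul_le_of_le {x y a b : ℕ} (hx : Nat.size x ≤ a) (hy : Nat.size y ≤ b) :
    Nat.size (x * y) ≤ a + b := by
  rw [Nat.size_le] at *
  rw [pow_add]
  exact Nat.mul_lt_mul'' hx hy

theorem Expr.size_eval_le {s : State} {b b₀ : ℕ} (hb : ∀ a i, Nat.size (s a i) ≤ b)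
    (hb₀ : ∀ i, Nat.size (s 0 i) ≤ b₀) (e : Expr) (he : e.tame = true) :
    Nat.size (e.eval s) ≤ b + e.weight * (b₀ + 1) := by
  induction e with
  | const k => simp only [eval, weight]; nlinarith
  | get a e => exact (hb _ _).trans (Nat.le_add_right _ _)
  | add e f ihe ihf =>
    simp only [tame, Bool.and_eq_true] at he
    refine (size_add_le_of_le (b := b + (e.weight + f.weight) * (b₀ + 1))
      ((ihe he.1).trans (by nlinarith)) ((ihf he.2).trans (by nlinarith))).trans ?_
    simp only [weight]; nlinarith
  | sub e f ihe ihf =>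
    simp only [tame, Bool.and_eq_true] at he
    refine (Nat.size_le_size (Nat.sub_le _ _)).trans ((ihe he.1).trans ?_)
    simp only [weight]; nlinarith
  | mul e f ihe ihf =>
    simp only [tame, Bool.and_eq_true] at he
    have hf : Nat.size (f.eval s) ≤ b₀ := by
      obtain ⟨_, hf⟩ := he
      unfold isInput at hf
      split at hf
      · exact hb₀ _
      · cases hf
    refine (size_mul_le_of_le (ihe he.1.1) hf).trans ?_
    simp only [weight]; nlinarith
  | div e f ihe ihf =>
    simp only [tame, Bool.and_eq_true] at he
    refine (Nat.size_le_size (Nat.div_le_self _ _)).trans ((ihe he.1).trans ?_)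
    simp only [weight]; nlinarith

theorem Expr.cost_le {s : State} {b b₀ B : ℕ} (hb : ∀ a i, Nat.size (s a i) ≤ b)
    (hb₀ : ∀ i, Nat.size (s 0 i) ≤ b₀) (e : Expr) (he : e.tame = true)
    (hB : b + e.weight * (b₀ + 1) ≤ B) : e.cost s ≤ e.weight * (1 + B) := by
  have hs := (e.size_eval_le hb hb₀ he).trans hB
  induction e with
  | const k => simp only [cost, weight, eval] at *; nlinarith
  | get a e ih =>
    have h := ih he (by simp only [weight] at hB; nlinarith)
      ((e.size_eval_le hb hb₀ he).trans (by simp only [weight] at hB; nlinarith))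
    simp only [cost, weight, eval] at *; nlinarith
  | add e f ihe ihf | sub e f ihe ihf | div e f ihe ihf =>
    have he' := he
    simp only [tame, Bool.and_eq_true] at he'
    have h₁ : b + e.weight * (b₀ + 1) ≤ B := by simp only [weight] at hB; nlinarith
    have h₂ : b + f.weight * (b₀ + 1) ≤ B := by simp only [weight] at hB; nlinarith
    have k₁ := ihe he'.1 h₁ ((e.size_eval_le hb hb₀ he'.1).trans h₁)
    have k₂ := ihf he'.2 h₂ ((f.size_eval_le hb hb₀ he'.2).trans h₂)
    simp only [cost, weight, eval] at *; nlinarith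
  | mul e f ihe ihf =>
    have he' := he
    simp only [tame, Bool.and_eq_true] at he'
    have h₁ : b + e.weight * (b₀ + 1) ≤ B := by simp only [weight] at hB; nlinarith
    have h₂ : b + f.weight * (b₀ + 1) ≤ B := by simp only [weight] at hB; nlinarith
    have k₁ := ihe he'.1.1 h₁ ((e.size_eval_le hb hb₀ he'.1.1).trans h₁)
    have k₂ := ihf he'.1.2 h₂ ((f.size_eval_le hb hb₀ he'.1.2).trans h₂)
    simp only [cost, weight, eval] at *; nlinarith

theorem Steps.pos {c : Prog} {s r : State} {n : ℕ} (h : Steps c s n r) : 1 ≤ n := by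
  induction h <;> omega

/-- The logarithmic cost of a run of a tame program is polynomial in its number of steps and the
bit length `b₀` of the input: a step lengthens the numbers in memory by at most `W * (b₀ + 1)`
bits. -/
theorem Steps.exec {c : Prog} {s r : State} {n : ℕ} (h : Steps c s n r) {W b₀ : ℕ} :
    c.tame = true → c.weight ≤ W → (∀ i, Nat.size (s 0 i) ≤ b₀) →
    r 0 = s 0 ∧ ∀ b, (∀ a i, Nat.size (s a i) ≤ b) →
      (∀ a i, Nat.size (r a i) ≤ b + n * (W * (b₀ + 1))) ∧
      ∀ B, b + n * (W * (b₀ + 1)) ≤ B → ∃ t, Exec c s t r ∧ t ≤ n * (W * (1 + B)) := by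
  have test : ∀ {e : Expr} {s : State} {b k B : ℕ}, e.tame = true → 1 + e.weight ≤ W →
      (∀ i, Nat.size (s 0 i) ≤ b₀) → (∀ a i, Nat.size (s a i) ≤ b) →
      b + (1 + k) * (W * (b₀ + 1)) ≤ B → 1 + e.cost s ≤ W * (1 + B) := by
    intro e s b k B he hW h₀ hb hB
    have h₁ : e.weight * (b₀ + 1) ≤ W * (b₀ + 1) := Nat.mul_le_mul_right _ (by omega)
    have h₄ : 1 * (W * (b₀ + 1)) ≤ (1 + k) * (W * (b₀ + 1)) := Nat.mul_le_mul_right _ (by omega)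
    have h₂ := e.cost_le hb h₀ he (B := B) (by omega)
    have h₃ : (1 + e.weight) * (1 + B) ≤ W * (1 + B) := Nat.mul_le_mul_right _ hW
    nlinarith
  induction h with
  | skip s =>
    intro _ hW h₀
    refine ⟨rfl, fun b hb => ⟨fun a i => (hb a i).trans (by omega), fun B _ => ⟨1, .skip s, ?_⟩⟩⟩
    simp only [Prog.weight] at hW
    nlinarith
  | set s a i e =>
    intro hc hW h₀
    simp only [Prog.tame, Bool.and_eq_true, bne_iff_ne] at hc
    simp only [Prog.weight] at hW
    refine ⟨?_, fun b hb => ⟨?_, fun B hB => ⟨_, .set s a i e, ?_⟩⟩⟩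
    · simp [State.write, Function.update_of_ne (Ne.symm hc.1.1)]
    · intro a' i'
      have h₁ := e.size_eval_le hb h₀ hc.2
      have h₂ : e.weight * (b₀ + 1) ≤ W * (b₀ + 1) := Nat.mul_le_mul_right _ (by omega)
      have h₃ := hb a' i'
      simp only [State.write, Function.update_apply]
      split_ifs
      · simp only [Function.update_apply]
        split_ifs
        · omega
        · exact (hb _ _).trans (by omega)
      · omega
    · have hw₁ : i.weight * (b₀ + 1) ≤ W * (b₀ + 1) := Nat.mul_le_mul_right _ (by omega)
      have hw₂ : e.weight * (b₀ + 1) ≤ W * (b₀ + 1) := Nat.mul_le_mul_right _ (by omega)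
      have h₁ := i.cost_le hb h₀ hc.1.2 (B := B) (by omega)
      have h₂ := e.cost_le hb h₀ hc.2 (B := B) (by omega)
      have h₃ : (1 + i.weight + e.weight) * (1 + B) ≤ W * (1 + B) := Nat.mul_le_mul_right _ hW
      nlinarith
  | @seq c d s r q t k _ _ ihc ihd =>
    intro hc hW h₀
    simp only [Prog.tame, Bool.and_eq_true] at hc
    simp only [Prog.weight] at hW
    obtain ⟨e₁, h₁⟩ := ihc hc.1 (by omega) h₀
    obtain ⟨e₂, h₂⟩ := ihd hc.2 (by omega) (by rwa [e₁])
    refine ⟨e₂.trans e₁, fun b hb => ?_⟩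
    obtain ⟨g₁, k₁⟩ := h₁ b hb
    obtain ⟨g₂, k₂⟩ := h₂ _ g₁
    refine ⟨fun a i => (g₂ a i).trans (le_of_eq (by ring)), fun B hB => ?_⟩
    obtain ⟨t₁, x₁, l₁⟩ := k₁ B
      ((Nat.add_le_add_left (Nat.mul_le_mul_right _ (by omega)) _).trans hB)
    obtain ⟨t₂, x₂, l₂⟩ := k₂ B (by nlinarith)
    exact ⟨_, .seq x₁ x₂, by nlinarith⟩
  | @cond_true e c d s r t he _ ih =>
    intro hc hW h₀
    simp only [Prog.tame, Bool.and_eq_true] at hc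
    simp only [Prog.weight] at hW
    obtain ⟨e₁, h₁⟩ := ih hc.1.2 (by omega) h₀
    refine ⟨e₁, fun b hb => ?_⟩
    obtain ⟨g₁, k₁⟩ := h₁ b hb
    refine ⟨fun a i => (g₁ a i).trans (by nlinarith), fun B hB => ?_⟩
    obtain ⟨t₁, x₁, l₁⟩ := k₁ B (by nlinarith)
    have := test hc.1.1 (by omega) h₀ hb hB
    exact ⟨_, .cond_true he x₁, by nlinarith⟩
  | @cond_false e c d s r t he _ ih =>
    intro hc hW h₀
    simp only [Prog.tame, Bool.and_eq_true] at hc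
    simp only [Prog.weight] at hW
    obtain ⟨e₁, h₁⟩ := ih hc.2 (by omega) h₀
    refine ⟨e₁, fun b hb => ?_⟩
    obtain ⟨g₁, k₁⟩ := h₁ b hb
    refine ⟨fun a i => (g₁ a i).trans (by nlinarith), fun B hB => ?_⟩
    obtain ⟨t₁, x₁, l₁⟩ := k₁ B (by nlinarith)
    have := test hc.1.1 (by omega) h₀ hb hB
    exact ⟨_, .cond_false he x₁, by nlinarith⟩
  | @loop_true e c s r q t k he _ _ ihc ihl =>
    intro hc hW h₀
    have hc' := hc
    have hW' := hW
    simp only [Prog.tame, Bool.and_eq_true] at hc'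
    simp only [Prog.weight] at hW'
    obtain ⟨e₁, h₁⟩ := ihc hc'.2 (by omega) h₀
    obtain ⟨e₂, h₂⟩ := ihl hc hW (by rwa [e₁])
    refine ⟨e₂.trans e₁, fun b hb => ?_⟩
    obtain ⟨g₁, k₁⟩ := h₁ b hb
    obtain ⟨g₂, k₂⟩ := h₂ _ g₁
    refine ⟨fun a i => (g₂ a i).trans (by nlinarith), fun B hB => ?_⟩
    obtain ⟨t₁, x₁, l₁⟩ := k₁ B
      ((Nat.add_le_add_left (Nat.mul_le_mul_right _ (by omega)) _).trans hB)
    obtain ⟨t₂, x₂, l₂⟩ := k₂ B (by nlinarith)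
    have := test hc'.1 (by omega) h₀ hb (k := t + k) (B := B) (by nlinarith)
    exact ⟨_, .loop_true he x₁ x₂, by nlinarith⟩
  | @loop_false e c s he =>
    intro hc hW h₀
    simp only [Prog.tame, Bool.and_eq_true] at hc
    simp only [Prog.weight] at hW
    refine ⟨rfl, fun b hb => ⟨fun a i => (hb a i).trans (by omega), fun B hB =>
      ⟨_, .loop_false he, ?_⟩⟩⟩
    have := test hc.1 (by omega) h₀ hb (k := 0) (B := B) (by omega)
    omega

/-! ### Total correctness with automatic step bounds -/

/-- The arrays to which a program may write. -/
def Prog.mods : Prog → List ℕ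
  | skip => []
  | set a _ _ => [a]
  | seq c d => c.mods ++ d.mods
  | cond _ c d => c.mods ++ d.mods
  | loop _ c => c.mods

theorem Steps.frame {c : Prog} {s r : State} {n : ℕ} (h : Steps c s n r) :
    ∀ a, a ∉ c.mods → r a = s a := by
  induction h with
  | skip | loop_false => exact fun _ _ => rfl
  | set s a i e =>
    intro b hb
    simp only [Prog.mods, List.mem_singleton] at hb
    simp [State.write, Function.update_of_ne hb]
  | seq _ _ ihc ihd =>
    intro b hb
    simp only [Prog.mods, List.mem_append, not_or] at hb
    rw [ihd b hb.2, ihc b hb.1]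
  | cond_true _ _ ih =>
    intro b hb
    simp only [Prog.mods, List.mem_append, not_or] at hb
    exact ih b hb.1
  | cond_false _ _ ih =>
    intro b hb
    simp only [Prog.mods, List.mem_append, not_or] at hb
    exact ih b hb.2
  | loop_true _ _ _ ihc ihl => exact fun b hb => (ihl b hb).trans (ihc b hb)

open Polynomial in
/-- The largest number of steps of a program all of whose loops make at most `X` iterations. -/
noncomputable def Prog.stepBound : Prog → ℕ[X]
  | skip => 1
  | set _ _ _ => 1
  | seq c d => c.stepBound + d.stepBound
  | cond _ c d => 1 + c.stepBound + d.stepBound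
  | loop _ c => X * (1 + c.stepBound) + 1

/-- `Wp M c s Q`: started in `s`, the program `c` halts in a state satisfying `Q`, in the number of
steps corresponding to at most `M` iterations of each execution of a loop. -/
def Wp (M : ℕ) (c : Prog) (s : State) (Q : State → Prop) : Prop :=
  ∃ r n, n ≤ c.stepBound.eval M ∧ Steps c s n r ∧ Q r

variable {M : ℕ} {c d : Prog} {s : State} {Q R : State → Prop}

theorem Wp.mono (h : Wp M c s Q) (hQ : ∀ r, (∀ a, a ∉ c.mods → r a = s a) → Q r → R r) :
    Wp M c s R :=
  let ⟨r, n, hn, hs, hr⟩ := h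
  ⟨r, n, hn, hs, hQ r hs.frame hr⟩

theorem Wp.skip (h : Q s) : Wp M .skip s Q :=
  ⟨s, 1, by simp [Prog.stepBound], .skip s, h⟩

theorem Wp.set {a : ℕ} {i e : Expr} (h : Q (s.write a (i.eval s) (e.eval s))) :
    Wp M (.set a i e) s Q :=
  ⟨_, 1, by simp [Prog.stepBound], .set s a i e, h⟩

theorem Wp.seq (h : Wp M c s fun r => Wp M d r Q) : Wp M (.seq c d) s Q := by
  obtain ⟨r, n, hn, hs, r', n', hn', hs', hr⟩ := h
  exact ⟨r', n + n', by simp only [Prog.stepBound, Polynomial.eval_add]; omega, .seq hs hs', hr⟩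

theorem Wp.cond {e : Expr} (h₁ : e.eval s ≠ 0 → Wp M c s Q) (h₂ : e.eval s = 0 → Wp M d s Q) :
    Wp M (.cond e c d) s Q := by
  by_cases he : e.eval s = 0
  · obtain ⟨r, n, hn, hs, hr⟩ := h₂ he
    refine ⟨r, 1 + n, ?_, .cond_false he hs, hr⟩
    simp only [Prog.stepBound, Polynomial.eval_add, Polynomial.eval_one]; omega
  · obtain ⟨r, n, hn, hs, hr⟩ := h₁ he
    refine ⟨r, 1 + n, ?_, .cond_true he hs, hr⟩
    simp only [Prog.stepBound, Polynomial.eval_add, Polynomial.eval_one]; omega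

/-- The rule for loops: `I j` holds whenever at most `j` further iterations are made. -/
theorem Wp.loop {e : Expr} (I : ℕ → State → Prop) {J : ℕ} (hJ : J ≤ M) (hI : I J s)
    (step : ∀ j r, I j r → e.eval r ≠ 0 → ∃ i, j = i + 1 ∧ Wp M c r (I i))
    (fin : ∀ j r, I j r → e.eval r = 0 → Q r) : Wp M (.loop e c) s Q := by
  suffices h : ∀ j s, I j s → ∃ r n, n ≤ j * (1 + c.stepBound.eval M) + 1 ∧
      Steps (.loop e c) s n r ∧ Q r by
    obtain ⟨r, n, hn, hs, hr⟩ := h J s hI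
    refine ⟨r, n, hn.trans ?_, hs, hr⟩
    simp only [Prog.stepBound, Polynomial.eval_add, Polynomial.eval_one, Polynomial.eval_mul,
      Polynomial.eval_X]
    exact Nat.add_le_add_right (Nat.mul_le_mul_right _ hJ) 1
  intro j
  induction j with
  | zero =>
    intro s h
    by_cases he : e.eval s = 0
    · exact ⟨s, 1, by omega, .loop_false he, fin _ _ h he⟩
    · obtain ⟨i, hi, _⟩ := step _ _ h he
      omega
  | succ j ih =>
    intro s h
    by_cases he : e.eval s = 0
    · exact ⟨s, 1, by omega, .loop_false he, fin _ _ h he⟩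
    · obtain ⟨i, hi, r, n, hn, hs, hr⟩ := step _ _ h he
      obtain rfl : j = i := by omega
      obtain ⟨r', n', hn', hs', hr'⟩ := ih r hr
      exact ⟨r', 1 + n + n', by nlinarith, .loop_true he hs hs', hr'⟩

/-- The variable kept in cell `0` of an array. -/
def Expr.var (a : ℕ) : Expr := .get a (.const 0)

/-- Assignment to the variable kept in cell `0` of an array. -/
def Prog.assign (a : ℕ) (e : Expr) : Prog := .set a (.const 0) e

/-- `for i < e do c`, the counter `i` being the variable kept in cell `0` of array `i`. -/
def Prog.forUpTo (i : ℕ) (e : Expr) (c : Prog) : Prog :=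
  .seq (.assign i (.const 0))
    (.loop (.sub e (.var i)) (.seq c (.assign i (.add (.var i) (.const 1)))))

@[simp] theorem State.write_same (s : State) (a i x : ℕ) :
    s.write a i x a = Function.update (s a) i x := by
  simp [State.write]

@[simp] theorem State.write_of_ne (s : State) {a b : ℕ} (i x : ℕ) (h : b ≠ a) :
    s.write a i x b = s b := by
  simp [State.write, h]

@[simp] theorem Expr.eval_var (a : ℕ) : (Expr.var a).eval s = s a 0 := rfl

theorem Wp.assign {a : ℕ} {e : Expr} (h : Q (s.write a 0 (e.eval s))) :
    Wp M (.assign a e) s Q :=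
  Wp.set h

/-- The rule for counted loops. The invariant must not refer to the counter; the arrays that the
loop does not write to need not be mentioned in it. -/
theorem Wp.forUpTo {i : ℕ} {e : Expr} (I : ℕ → State → Prop) {K : ℕ} (hK : K ≤ M)
    (hi : i ∉ c.mods) (he : ∀ r, (∀ a, a ∉ i :: c.mods → r a = s a) → e.eval r = K)
    (hI : ∀ j r x, I j r → I j (r.write i 0 x)) (h₀ : I 0 s)
    (step : ∀ j r, j < K → (∀ a, a ∉ i :: c.mods → r a = s a) → r i 0 = j → I j r →
      Wp M c r (I (j + 1)))
    (fin : ∀ r, (∀ a, a ∉ i :: c.mods → r a = s a) → I K r → Q r) :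
    Wp M (.forUpTo i e c) s Q := by
  refine Wp.seq (Wp.assign (Wp.loop (fun k r => ∃ j, j + k = K ∧ r i 0 = j ∧
    (∀ a, a ∉ i :: c.mods → r a = s a) ∧ I j r) hK ⟨0, by simp, ?_, ?_, hI _ _ _ h₀⟩ ?_ ?_))
  · simp [Expr.eval]
  · intro a ha
    exact State.write_of_ne _ _ _ (List.ne_of_not_mem_cons ha)
  · rintro k r ⟨j, hj, hr, hf, h⟩ hne
    have hk : k ≠ 0 := by
      rintro rfl
      apply hne
      simp only [Expr.eval, he r hf, Expr.eval_var]
      omega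
    obtain ⟨k, rfl⟩ := Nat.exists_eq_succ_of_ne_zero hk
    refine ⟨k, rfl, Wp.seq ((step j r (by omega) hf hr h).mono fun r' hf' h' => Wp.assign ?_)⟩
    refine ⟨j + 1, by omega, ?_, ?_, hI _ _ _ h'⟩
    · simp [Expr.eval, hf' i hi, hr]
    · intro a ha
      rw [State.write_of_ne _ _ _ (List.ne_of_not_mem_cons ha),
        hf' a (List.not_mem_of_not_mem_cons ha), hf a ha]
  · rintro k r ⟨j, hj, hr, hf, h⟩ heq
    simp only [Expr.eval, he r hf, Expr.eval_var] at heq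
    obtain rfl : j = K := by omega
    exact fin r hf h

end RAM

/-! ### Connected sets and splits as labellings -/

namespace MMS

/-- A set of vertices is linked if every predicate that is closed along the edges within the set
and holds somewhere in it holds everywhere in it. -/
def Linked {V : Type*} (G : SimpleGraph V) (S : Set V) : Prop :=
  ∀ p : V → Prop, (∀ a ∈ S, ∀ b ∈ S, G.Adj a b → p a → p b) → ∀ a ∈ S, ∀ b ∈ S, p a → p b

theorem induce_preconnected_iff_linked {V : Type*} {G : SimpleGraph V} {S : Set V} :
    (G.induce S).Preconnected ↔ Linked G S := by
  constructor
  · intro h p hp a ha b hb hpa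
    have := h ⟨a, ha⟩ ⟨b, hb⟩
    rw [SimpleGraph.reachable_iff_reflTransGen] at this
    have key : ∀ x : S, Relation.ReflTransGen (G.induce S).Adj ⟨a, ha⟩ x → p x := by
      intro x hx
      induction hx with
      | refl => exact hpa
      | @tail y z _ hyz ih => exact hp y y.2 z z.2 hyz ih
    exact key _ this
  · rintro h ⟨a, ha⟩ ⟨b, hb⟩
    obtain ⟨_, hr⟩ := h (fun x => ∃ hx : x ∈ S, (G.induce S).Reachable ⟨a, ha⟩ ⟨x, hx⟩)
      (fun x _ y hy hxy ⟨hx, hr⟩ => ⟨hy, hr.trans (SimpleGraph.Adj.reachable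
        (G := G.induce S) (u := ⟨x, hx⟩) (v := ⟨y, hy⟩) hxy)⟩) a ha b hb ⟨ha, .rfl⟩
    exact hr

theorem Linked.of_subsingleton {V : Type*} (G : SimpleGraph V) {S : Set V}
    (h : S.Subsingleton) : Linked G S := fun _ _ _ ha _ hb hp => h ha hb ▸ hp

theorem Linked.union {V : Type*} {G : SimpleGraph V} {S S' : Set V} (h : Linked G S)
    (h' : Linked G S') {v w : V} (hv : v ∈ S) (hw : w ∈ S') (hvw : G.Adj v w) :
    Linked G (S ∪ S') := by
  intro p hp a ha b hb hpa
  have k := h p fun x hx y hy => hp x (.inl hx) y (.inl hy)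
  have k' := h' p fun x hx y hy => hp x (.inr hx) y (.inr hy)
  have e := hp v (.inl hv) w (.inr hw) hvw
  have e' := hp w (.inr hw) v (.inl hv) hvw.symm
  rcases ha with ha | ha <;> rcases hb with hb | hb
  · exact k a ha b hb hpa
  · exact k' w hw b hb (e (k a ha v hv hpa))
  · exact k v hv b hb (e' (k' a ha w hw hpa))
  · exact k' a ha b hb hpa

/-- Removing a vertex with at most one neighbour from a linked set leaves it linked. -/
theorem Linked.diff_singleton {V : Type*} {G : SimpleGraph V} {S : Set V} (h : Linked G S)
    {v w : V} (hw : ∀ x ∈ S, G.Adj v x → x = w) : Linked G (S \ {v}) := by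
  classical
  intro p hp a ha b hb hpa
  have key := h (fun x => if x = v then p w else p x) (fun x hx y hy hxy hpx => by
    by_cases hxv : x = v
    · subst hxv
      have hyw := hw y hy hxy
      have : y ≠ x := hxy.ne'
      subst hyw
      simpa [this] using hpx
    · by_cases hyv : y = v
      · subst hyv
        have hxw := hw x hx hxy.symm
        subst hxw
        simpa [hxv] using hpx
      · simp only [hxv, hyv, if_false] at hpx ⊢
        exact hp x ⟨hx, hxv⟩ y ⟨hy, hyv⟩ hxy hpx) a ha.1 b hb.1 (by
    have : a ≠ v := ha.2
    simpa [this] using hpa)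
  have : b ≠ v := hb.2
  simpa [this] using key

variable {m : ℕ} {U T : SimpleGraph (Fin m)} {u : Fin m → ℕ} {n q : ℕ}

/-- The total integer utility of the vertices carrying the label `j`. -/
def weigh (u f : Fin m → ℕ) (j : ℕ) : ℕ := ∑ x with f x = j, u x

/-- The labels `0, …, n - 1` of `f` define a split all of whose bundles have value at least `q`. -/
structure IsGood (U : SimpleGraph (Fin m)) (u : Fin m → ℕ) (n q : ℕ) (f : Fin m → ℕ) : Prop where
  lt : ∀ x, f x < n
  linked : ∀ j, Linked U {x | f x = j}
  le : ∀ j < n, q ≤ weigh u f j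

/-- The graph `U` without the edge represented by the position `e` of the adjacency matrix. -/
def cutEdge (U : SimpleGraph (Fin m)) (e : ℕ) : SimpleGraph (Fin m) where
  Adj v w := U.Adj v w ∧ (v : ℕ) * m + w ≠ e ∧ (w : ℕ) * m + v ≠ e
  symm := ⟨fun _ _ h => ⟨h.1.symm, h.2.2, h.2.1⟩⟩
  loopless := ⟨fun _ h => h.1.ne rfl⟩

theorem cutEdge_le (e : ℕ) : cutEdge U e ≤ U := fun _ _ h => h.1

theorem row_col_inj {a b c d : Fin m} :
    (a : ℕ) * m + b = c * m + d ↔ a = c ∧ b = d := by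
  constructor
  · intro h
    have h₁ := congrArg (· / m) h
    have h₂ := congrArg (· % m) h
    have hm : 0 < m := a.pos
    simp only [mul_comm _ m, Nat.mul_add_div hm, Nat.div_eq_of_lt b.2, Nat.div_eq_of_lt d.2,
      Nat.mul_add_mod, Nat.mod_eq_of_lt b.2, Nat.mod_eq_of_lt d.2] at h₁ h₂
    exact ⟨Fin.ext (by simpa using h₁), Fin.ext h₂⟩
  · rintro ⟨rfl, rfl⟩; rfl

theorem cutEdge_eq_deleteEdges (a b : Fin m) :
    cutEdge U (a * m + b) = U.deleteEdges {s(a, b)} := by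
  ext v w
  simp only [cutEdge, ne_eq, row_col_inj, SimpleGraph.deleteEdges_adj, Set.mem_singleton_iff,
    Sym2.eq_iff]
  tauto

/-- `T` is a tree and has `n` disjoint connected sets of vertices of value at least `q` each. -/
def Packable (T : SimpleGraph (Fin m)) (u : Fin m → ℕ) (n q : ℕ) : Prop :=
  T.Connected ∧ T.IsAcyclic ∧
    ∃ f : Fin m → ℕ, ∀ j < n, Linked T {x | f x = j} ∧ q ≤ weigh u f j

theorem iff_of_walk {V : Type*} {G : SimpleGraph V} {p : V → Prop} {x y : V} (w : G.Walk x y)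
    (h : ∀ a b, s(a, b) ∈ w.edges → (p a ↔ p b)) : p x ↔ p y := by
  induction w with
  | nil => rfl
  | cons _ _ ih =>
    exact (h _ _ (by simp)).trans (ih fun a b hab => h a b (by simp [hab]))

/-- Every split of a unicyclic graph is a split of one of the trees obtained by deleting an edge
of the cycle: an edge between two bundles if there is one on the cycle, and any edge of the cycle
if the cycle lies within a bundle. -/
theorem IsGood.exists_packable {f : Fin m → ℕ} (hU : IsUnicyclic U) (hf : IsGood U u n q f) :
    ∃ e < m * m, Packable (cutEdge U e) u n q := by
  obtain ⟨hconn, C, ⟨v₀, w, hw, rfl⟩, huniq⟩ := hU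
  have tree : ∀ a b, s(a, b) ∈ w.edges →
      (U.deleteEdges {s(a, b)}).Connected ∧ (U.deleteEdges {s(a, b)}).IsAcyclic := by
    intro a b hab
    refine ⟨hconn.connected_delete_edge_of_not_isBridge fun h => h.notMem_edges_of_isCycle hw hab,
      fun x c hc => ?_⟩
    have h₁ := huniq _ ⟨x, _, hc.mapLe (U.deleteEdges_le {s(a, b)}), rfl⟩
    have h₂ : s(a, b) ∈ (c.mapLe (U.deleteEdges_le {s(a, b)})).edges := h₁.symm.subset hab
    rw [SimpleGraph.Walk.edges_mapLe_eq_edges] at h₂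
    have h₃ := c.edges_subset_edgeSet h₂
    simp at h₃
  suffices h : ∃ a b, s(a, b) ∈ w.edges ∧ ∀ j, Linked (U.deleteEdges {s(a, b)}) {x | f x = j} by
    obtain ⟨a, b, hab, hl⟩ := h
    refine ⟨a * m + b, by nlinarith [a.2, b.2], ?_⟩
    rw [cutEdge_eq_deleteEdges]
    exact ⟨(tree a b hab).1, (tree a b hab).2, f, fun j hj => ⟨hl j, hf.le j hj⟩⟩
  by_cases hsame : ∀ a b, s(a, b) ∈ w.edges → f a = f b
  · cases w with
    | nil => exact absurd hw SimpleGraph.Walk.not_isCycle_nil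
    | @cons _ v₁ _ hadj p =>
      obtain ⟨_, hp⟩ := (SimpleGraph.Walk.cons_isCycle_iff p hadj).1 hw
      refine ⟨v₀, v₁, by simp, fun j P hP => hf.linked j P fun a ha b hb hab hPa => ?_⟩
      by_cases he : s(a, b) = s(v₀, v₁)
      swap
      · exact hP a ha b hb (by simp [hab, he]) hPa
      -- The ends of the deleted edge are joined by the rest of the cycle, which has one label.
      have hj : ∀ x y, f x = j → f y = j → s(x, y) ∈ p.edges → P x → P y := fun x y hx hy hxy =>
        hP x hx y hy (by
          simp only [SimpleGraph.deleteEdges_adj, Set.mem_singleton_iff]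
          exact ⟨p.edges_subset_edgeSet hxy, fun h => hp (h ▸ hxy)⟩)
      have h₁ : (f v₁ = j ∧ P v₁) ↔ (f v₀ = j ∧ P v₀) := by
        refine iff_of_walk (p := fun x => f x = j ∧ P x) p fun x y hxy => ?_
        have hfxy := hsame x y (by simp [hxy])
        have hyx : s(y, x) ∈ p.edges := by rwa [Sym2.eq_swap]
        exact ⟨fun h => ⟨hfxy ▸ h.1, hj x y h.1 (hfxy ▸ h.1) hxy h.2⟩,
          fun h => ⟨hfxy.symm ▸ h.1, hj y x h.1 (hfxy.symm ▸ h.1) hyx h.2⟩⟩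
      rcases Sym2.eq_iff.1 he with ⟨rfl, rfl⟩ | ⟨rfl, rfl⟩
      · exact (h₁.2 ⟨ha, hPa⟩).2
      · exact (h₁.1 ⟨ha, hPa⟩).2
  · push Not at hsame
    obtain ⟨a, b, hab, hne⟩ := hsame
    refine ⟨a, b, hab, fun j P hP => hf.linked j P fun x hx y hy hxy hPx => ?_⟩
    refine hP x hx y hy ?_ hPx
    simp only [SimpleGraph.deleteEdges_adj, Set.mem_singleton_iff]
    refine ⟨hxy, fun h => hne ?_⟩
    rcases Sym2.eq_iff.1 h with ⟨rfl, rfl⟩ | ⟨rfl, rfl⟩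
    · exact hx.trans hy.symm
    · exact hy.trans hx.symm

/-! ### Stripping leaves -/

/-- A configuration of the leaf-stripping procedure. The vertices `v` with `grp v = v` are live;
each of them represents the group of the vertices labelled `v`, whose value is `acc v`. Vertices of
the completed bundle with number `j` are labelled `m + j`. There remain `k` bundles to be formed,
there are `c` live vertices, and `last` is one of them. -/
structure Cfg where
  grp : ℕ → ℕ
  acc : ℕ → ℕ
  k : ℕ
  c : ℕ
  last : ℕ

/-- The vertices below `m` labelled `v` receive the label `t`. -/
def relabel (m : ℕ) (g : ℕ → ℕ) (v t : ℕ) : ℕ → ℕ := fun x => if x < m ∧ g x = v then t else g x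

/-- Strips the leaf `v` with live neighbour `w`: the group of `v` is made a bundle if its value
suffices and it is not the last bundle to be formed; otherwise it is merged into that of `w`. -/
def Cfg.strip (m q v w : ℕ) (σ : Cfg) : Cfg :=
  if q ≤ σ.acc v ∧ 2 ≤ σ.k then
    ⟨relabel m σ.grp v (m + (σ.k - 1)), σ.acc, σ.k - 1, σ.c - 1, w⟩
  else
    ⟨relabel m σ.grp v w, Function.update σ.acc w (σ.acc w + σ.acc v), σ.k, σ.c - 1, w⟩

/-- `v` is a live vertex and `w` is its only live neighbour. -/
def IsLeaf (T : SimpleGraph (Fin m)) (g : ℕ → ℕ) (v w : Fin m) : Prop :=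
  g v = v ∧ g w = w ∧ T.Adj v w ∧ ∀ x : Fin m, g x = x → T.Adj v x → x = w

/-- The groups and the completed bundles are connected, the latter have value at least `q`, and
the bookkeeping is right. -/
structure Sound (U : SimpleGraph (Fin m)) (u : Fin m → ℕ) (n q : ℕ) (σ : Cfg) : Prop where
  one_le : 1 ≤ σ.k
  le : σ.k ≤ n
  label : ∀ x : Fin m, (∃ v : Fin m, σ.grp x = v ∧ σ.grp v = v) ∨
    ∃ j, σ.k ≤ j ∧ j < n ∧ σ.grp x = m + j
  card : σ.c = (Finset.univ.filter fun v : Fin m => σ.grp v = v).card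
  last : ∃ v : Fin m, σ.last = v ∧ σ.grp v = v
  acc : ∀ v : Fin m, σ.grp v = v → σ.acc v = weigh u (fun x => σ.grp x) v
  linked : ∀ y, Linked U {x | σ.grp x = y}
  full : ∀ j, σ.k ≤ j → j < n → q ≤ weigh u (fun x => σ.grp x) (m + j)

/-- The live vertices are connected in `T`, and they contain `k` disjoint connected sets of value
at least `q`, the value of a vertex being that of its group. -/
def Packs (T : SimpleGraph (Fin m)) (q : ℕ) (σ : Cfg) : Prop :=
  Linked T {x | σ.grp x = x} ∧ ∃ (g : Fin m → ℕ) (I : Finset ℕ), σ.k ≤ I.card ∧ ∀ j ∈ I,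
    Linked T {x | σ.grp x = x ∧ g x = j} ∧
      q ≤ ∑ x ∈ (Finset.univ.filter fun x : Fin m => σ.grp x = x ∧ g x = j), σ.acc x

/-- The configuration in which every vertex is a group of its own. -/
def Cfg.IsStart (u : Fin m → ℕ) (n : ℕ) (σ : Cfg) : Prop :=
  (∀ x : Fin m, σ.grp x = x ∧ σ.acc x = u x) ∧ σ.k = n ∧ σ.c = m ∧ σ.last = 0

theorem Cfg.IsStart.sound {σ : Cfg} (h : σ.IsStart u n) (hn : 1 ≤ n) (hm : 0 < m) :
    Sound U u n q σ := by
  obtain ⟨h, hk, hc, hl⟩ := h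
  refine ⟨by omega, by omega, fun x => .inl ⟨x, (h x).1, (h x).1⟩, ?_, ⟨⟨0, hm⟩, hl, (h _).1⟩,
    ?_, ?_, fun j _ _ => by omega⟩
  · simp [h, hc]
  · intro v _
    have : ∀ x : Fin m, (x : ℕ) = v ↔ x = v := fun x => Fin.val_inj
    simp [weigh, h, this, Finset.filter_eq']
  · intro y
    refine Linked.of_subsingleton _ fun a ha b hb => ?_
    simp only [Set.mem_ofPred_eq, h] at ha hb
    exact Fin.ext (ha.trans hb.symm)

theorem Cfg.IsStart.packs {σ : Cfg} (h : σ.IsStart u n) (hT : Packable T u n q) :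
    Packs T q σ := by
  obtain ⟨h, hk, hc, hl⟩ := h
  obtain ⟨hconn, _, f, hf⟩ := hT
  refine ⟨?_, f, Finset.range n, by simp [hk], fun j hj => ?_⟩
  · have : {x : Fin m | σ.grp x = x} = Set.univ := by ext x; simp [h]
    rw [this, ← induce_preconnected_iff_linked]
    exact (SimpleGraph.induceUnivIso T).preconnected_iff.2 hconn.preconnected
  · have := hf j (by simpa using hj)
    simpa [h, weigh] using this

/-- While a tree has at least two live vertices, one of them is a leaf. -/
theorem exists_isLeaf {g : ℕ → ℕ} (hT : T.IsAcyclic) (hl : Linked T {x | g x = x})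
    (hc : 2 ≤ (Finset.univ.filter fun v : Fin m => g v = v).card) : ∃ v w, IsLeaf T g v w := by
  classical
  let L : Set (Fin m) := {x | g x = x}
  obtain ⟨a, ha, b, hb, hab⟩ := Finset.one_lt_card.1 hc
  have : Nontrivial L := ⟨⟨a, (Finset.mem_filter.1 ha).2⟩, ⟨b, (Finset.mem_filter.1 hb).2⟩,
    by simpa using hab⟩
  have htree : (T.induce L).IsTree :=
    { connected := ⟨induce_preconnected_iff_linked.2 hl⟩, isAcyclic := hT.induce L }
  obtain ⟨⟨v, hv⟩, hdeg⟩ := htree.exists_vert_degree_one_of_nontrivial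
  obtain ⟨⟨w, hw⟩, hvw, hu⟩ := SimpleGraph.degree_eq_one_iff_existsUnique_adj.1 hdeg
  exact ⟨v, w, hv, hw, hvw, fun x hx hvx => congrArg Subtype.val (hu ⟨x, hx⟩ hvx)⟩

section Strip

variable {σ : Cfg} {v w : Fin m}

/-- Relabelling the group of a live vertex by another live vertex or a completed bundle makes just
that vertex cease to be live. -/
theorem relabel_eq_self_iff {g : ℕ → ℕ} {t : ℕ} (hv : g v = v) (ht : t ≠ v)
    (ht' : m ≤ t ∨ g t = t) (x : Fin m) : relabel m g v t x = x ↔ g x = x ∧ x ≠ v := by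
  unfold relabel
  by_cases hx : g x = v
  · simp only [x.2, hx, true_and, if_true]
    constructor
    · rintro rfl
      rcases ht' with h | h
      · exact absurd x.2 (by omega)
      · exact absurd (h.symm.trans hx) ht
    · rintro ⟨h, h'⟩
      exact absurd (Fin.ext h.symm) h'
  · simp only [hx, and_false, if_false]
    exact ⟨fun h => ⟨h, fun h' => hx (by rw [h', hv])⟩, fun h => h.1⟩

theorem weigh_relabel_of_ne {g : ℕ → ℕ} {v t y : ℕ} (hy : y ≠ v) (hyt : y ≠ t) :
    weigh u (fun x => relabel m g v t x) y = weigh u (fun x => g x) y := by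
  unfold weigh relabel
  congr 1
  ext x
  simp only [x.2, true_and, Finset.mem_filter, Finset.mem_univ]
  split_ifs with h
  · simp [h, hyt.symm, hy.symm]
  · rfl

theorem weigh_relabel_self {g : ℕ → ℕ} {v t : ℕ} (ht : t ≠ v) :
    weigh u (fun x => relabel m g v t x) t =
      weigh u (fun x => g x) t + weigh u (fun x => g x) v := by
  unfold weigh
  rw [← Finset.sum_union (Finset.disjoint_filter.2 fun x _ h h' => ht (h.symm.trans h'))]
  congr 1
  ext x
  by_cases h : g x = v <;> simp [relabel, h]

theorem Sound.strip (hσ : Sound U u n q σ) (hT : T ≤ U) (h : IsLeaf T σ.grp v w) :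
    Sound U u n q (σ.strip m q v w) := by
  obtain ⟨hv, hw, hvw, -⟩ := h
  have hne : w ≠ v := hvw.ne'
  have hne' : (w : ℕ) ≠ v := fun h => hne (Fin.ext h)
  have vlt := v.2
  have card : ∀ t, t ≠ (v : ℕ) → (m ≤ t ∨ σ.grp t = t) →
      σ.c - 1 = (Finset.univ.filter fun x : Fin m => relabel m σ.grp v t x = x).card := by
    intro t ht ht'
    rw [hσ.card, ← Finset.card_erase_of_mem (a := v) (by simp [hv])]
    congr 1
    ext x
    simp only [Finset.mem_erase, Finset.mem_filter, Finset.mem_univ, true_and,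
      relabel_eq_self_iff hv ht ht' x]
    tauto
  have setOf_ne : ∀ t y, y ≠ t → {x : Fin m | relabel m σ.grp v t x = y} =
      if y = v then ∅ else {x : Fin m | σ.grp x = y} := by
    intro t y hy
    ext x
    by_cases hyv : y = v
    · subst hyv
      simp only [relabel, x.2, true_and, Set.mem_ofPred_eq, if_true, Set.mem_empty_iff_false,
        iff_false]
      split_ifs with h
      · exact hy.symm
      · exact h
    · simp only [relabel, x.2, true_and, Set.mem_ofPred_eq, hyv, if_false]
      split_ifs with h
      · simp [h, hy.symm, Ne.symm hyv]
      · rfl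
  have setOf_self : ∀ t, {x : Fin m | relabel m σ.grp v t x = t} =
      {x : Fin m | σ.grp x = v} ∪ {x : Fin m | σ.grp x = t} := by
    intro t
    ext x
    simp only [relabel, x.2, true_and, Set.mem_ofPred_eq, Set.mem_union]
    split_ifs with h <;> simp [h]
  have linked_ne : ∀ t y, y ≠ t → Linked U {x : Fin m | relabel m σ.grp v t x = y} := by
    intro t y hy
    rw [setOf_ne t y hy]
    split_ifs
    · exact Linked.of_subsingleton _ Set.subsingleton_empty
    · exact hσ.linked y
  have hacc := hσ.acc v hv
  unfold Cfg.strip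
  split_ifs with hq
  · have ht : m + (σ.k - 1) ≠ v := by omega
    have fresh : ∀ x : Fin m, σ.grp x ≠ m + (σ.k - 1) := by
      intro x hx
      rcases hσ.label x with ⟨z, hz, _⟩ | ⟨j, hj, _, hz⟩
      · have := z.2; omega
      · omega
    refine ⟨by dsimp only; omega, by have := hσ.le; dsimp only; omega, fun x => ?_,
      card _ ht (.inl (by omega)), ⟨w, rfl, ?_⟩, fun y hy => ?_, fun y => ?_, fun j hj hjn => ?_⟩
    · simp only [relabel, x.2, true_and]
      split_ifs with hx
      · exact .inr ⟨σ.k - 1, le_rfl, by have := hσ.le; omega, rfl⟩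
      · rcases hσ.label x with ⟨z, hz, hz'⟩ | ⟨j, hj, hjn, hz⟩
        · refine .inl ⟨z, hz, ?_⟩
          rw [if_neg]
          · exact hz'
          · rintro ⟨_, h⟩
            exact hx (by rw [hz, ← hz', h])
        · exact .inr ⟨j, by omega, hjn, hz⟩
    · exact (relabel_eq_self_iff hv ht (.inl (by omega)) w).2 ⟨hw, hne⟩
    · have := (relabel_eq_self_iff hv ht (.inl (by omega)) y).1 hy
      have hyv : (y : ℕ) ≠ v := fun h => this.2 (Fin.ext h)
      have := y.2
      dsimp only
      rw [weigh_relabel_of_ne hyv (by omega)]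
      exact hσ.acc y (by tauto)
    · by_cases hy : y = m + (σ.k - 1)
      · subst hy
        dsimp only
        rw [setOf_self]
        have : {x : Fin m | σ.grp x = m + (σ.k - 1)} = ∅ := by ext x; simp [fresh x]
        rw [this, Set.union_empty]
        exact hσ.linked v
      · exact linked_ne _ _ hy
    · dsimp only at hj ⊢
      by_cases hj' : j = σ.k - 1
      · subst hj'
        rw [weigh_relabel_self ht, ← hacc]
        omega
      · rw [weigh_relabel_of_ne (by omega) (by omega)]
        exact hσ.full j (by omega) hjn
  · refine ⟨hσ.one_le, hσ.le, fun x => ?_,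
      card _ hne' (.inr hw), ⟨w, rfl, ?_⟩, fun y hy => ?_, fun y => ?_, fun j hj hjn => ?_⟩
    · simp only [relabel, x.2, true_and]
      split_ifs with hx
      · refine .inl ⟨w, rfl, ?_⟩
        rw [if_neg]
        · exact hw
        · rintro ⟨_, h⟩
          exact hne' (by rw [← hw, h])
      · rcases hσ.label x with ⟨z, hz, hz'⟩ | ⟨j, hj, hjn, hz⟩
        · refine .inl ⟨z, hz, ?_⟩
          rw [if_neg]
          · exact hz'
          · rintro ⟨_, h⟩
            exact hx (by rw [hz, ← hz', h])
        · exact .inr ⟨j, by omega, hjn, hz⟩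
    · exact (relabel_eq_self_iff hv hne' (.inr hw) w).2 ⟨hw, hne⟩
    · obtain ⟨hy₁, hy₂⟩ := (relabel_eq_self_iff hv hne' (.inr hw) y).1 hy
      have hyv : (y : ℕ) ≠ v := fun h => hy₂ (Fin.ext h)
      dsimp only
      by_cases hyw : (y : ℕ) = w
      · rw [hyw, weigh_relabel_self hne', Function.update_self, hσ.acc w hw, hacc]
      · rw [weigh_relabel_of_ne hyv hyw, Function.update_of_ne hyw, hσ.acc y hy₁]
    · by_cases hy : y = w
      · subst hy
        dsimp only
        rw [setOf_self]
        exact (hσ.linked v).union (hσ.linked w) hv hw (hT hvw)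
      · exact linked_ne _ _ hy
    · dsimp only at hj ⊢
      have := w.2
      rw [weigh_relabel_of_ne (by omega) (by omega)]
      exact hσ.full j hj hjn

theorem Packs.strip (hσ : Packs T q σ) (h : IsLeaf T σ.grp v w) :
    Packs T q (σ.strip m q v w) := by
  obtain ⟨hl, g, I, hI, hg⟩ := hσ
  obtain ⟨hv, hw, hvw, huniq⟩ := h
  have hne : w ≠ v := hvw.ne'
  have hne' : (w : ℕ) ≠ v := fun h => hne (Fin.ext h)
  have vlt := v.2
  have live : ∀ t, t ≠ (v : ℕ) → (m ≤ t ∨ σ.grp t = t) →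
      Linked T {x : Fin m | relabel m σ.grp v t x = x} := by
    intro t ht ht'
    have : {x : Fin m | relabel m σ.grp v t x = x} = {x : Fin m | σ.grp x = x} \ {v} := by
      ext x
      simp [relabel_eq_self_iff hv ht ht' x]
    rw [this]
    exact hl.diff_singleton huniq
  have eraseLinked : ∀ t, t ≠ (v : ℕ) → (m ≤ t ∨ σ.grp t = t) → ∀ j ∈ I,
      Linked T {x : Fin m | relabel m σ.grp v t x = x ∧ g x = j} := by
    intro t ht ht' j hj
    have : {x : Fin m | relabel m σ.grp v t x = x ∧ g x = j} =
        {x : Fin m | σ.grp x = x ∧ g x = j} \ {v} := by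
      ext x
      simp only [relabel_eq_self_iff hv ht ht' x, Set.mem_ofPred_eq, Set.mem_sdiff,
        Set.mem_singleton_iff]
      tauto
    rw [this]
    exact (hg j hj).1.diff_singleton fun x hx => huniq x hx.1
  have hacc : ∀ x, Function.update σ.acc w (σ.acc w + σ.acc v) x =
      σ.acc x + if x = w then σ.acc v else 0 := by
    intro x
    by_cases hx : x = w
    · simp [hx]
    · simp [hx]
  unfold Cfg.strip
  split_ifs with hq
  · -- The set containing `v` is given up; its label is removed from `I`.
    have ht : m + (σ.k - 1) ≠ v := by omega
    refine ⟨live _ ht (.inl (by omega)), g, I.erase (g v), ?_, fun j hj => ?_⟩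
    · have := Finset.pred_card_le_card_erase (s := I) (a := g v)
      dsimp only
      omega
    · obtain ⟨hjv, hj⟩ := Finset.mem_erase.1 hj
      refine ⟨eraseLinked _ ht (.inl (by omega)) j hj, (hg j hj).2.trans (le_of_eq ?_)⟩
      dsimp only
      refine Finset.sum_congr ?_ fun _ _ => rfl
      ext x
      simp only [relabel_eq_self_iff hv ht (.inl (by omega)) x, Finset.mem_filter,
        Finset.mem_univ, true_and]
      constructor
      · rintro ⟨h₁, h₂⟩
        exact ⟨⟨h₁, fun h => hjv (by rw [← h₂, h])⟩, h₂⟩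
      · tauto
  · by_cases hqv : q ≤ σ.acc v
    · -- A single set is left to be found, and `{w}` will do.
      refine ⟨live _ hne' (.inr hw), fun x => if x = w then 0 else 1, {0}, ?_, fun j hj => ?_⟩
      · dsimp only
        simp
        omega
      · obtain rfl := Finset.mem_singleton.1 hj
        have hs : ∀ x : Fin m, (relabel m σ.grp v w x = x ∧ (if x = w then 0 else 1) = 0) ↔
            x = w := by
          intro x
          rw [relabel_eq_self_iff hv hne' (.inr hw) x]
          constructor
          · rintro ⟨_, h⟩
            by_contra hx
            simp [hx] at h
          · rintro rfl
            simp [hw, hne]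
        dsimp only
        simp only [hs]
        refine ⟨Linked.of_subsingleton _ fun a ha b hb => ha.trans hb.symm, ?_⟩
        rw [Finset.filter_eq', if_pos (Finset.mem_univ _), Finset.sum_singleton, hacc]
        simp
        omega
    · refine ⟨live _ hne' (.inr hw), g, I, hI, fun j hj =>
        ⟨eraseLinked _ hne' (.inr hw) j hj, ?_⟩⟩
      have hs : (Finset.univ.filter fun x : Fin m => relabel m σ.grp v w x = x ∧ g x = j) =
          (Finset.univ.filter fun x : Fin m => σ.grp x = x ∧ g x = j).erase v := by
        ext x
        simp only [relabel_eq_self_iff hv hne' (.inr hw) x, Finset.mem_filter, Finset.mem_univ,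
          true_and, Finset.mem_erase]
        tauto
      dsimp only
      rw [hs]
      obtain ⟨hjl, hjq⟩ := hg j hj
      by_cases hvj : g v = j
      swap
      · rw [Finset.erase_eq_of_notMem (by simp [hvj])]
        refine hjq.trans (Finset.sum_le_sum fun x _ => ?_)
        rw [hacc]
        omega
      -- The set containing `v` is not `{v}`, so it also contains `w`.
      have hwj : g w = j := by
        by_contra hwj
        have hsingle : ∀ x : Fin m, σ.grp x = x ∧ g x = j → x = v := fun x hx =>
          hjl (fun y => y = v) (fun a ha b hb hab hav => by
            subst hav
            exact absurd (huniq b hb.1 hab ▸ hb.2) hwj) v ⟨hv, hvj⟩ x hx rfl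
        refine hqv (hjq.trans ?_)
        rw [Finset.sum_eq_single_of_mem v (by simp [hv, hvj])]
        intro x hx hxv
        exact absurd (hsingle x (by simpa using hx)) hxv
      refine hjq.trans ?_
      rw [← Finset.add_sum_erase _ (fun x : Fin m => σ.acc x) (a := v) (by simp [hv, hvj])]
      simp only [hacc, Finset.sum_add_distrib, Fin.val_inj]
      rw [Finset.sum_ite_eq' , if_pos (by simp [hne, hw, hwj]), add_comm]

end Strip

/-- When a single live vertex remains in a configuration that still packs, its group is the last
bundle. -/
theorem Packs.final {σ : Cfg} (hσ : Packs T q σ) (hs : Sound U u n q σ) (hq : 1 ≤ q)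
    (hc : σ.c = 1) : σ.k = 1 ∧ q ≤ σ.acc σ.last := by
  obtain ⟨-, g, I, hI, hg⟩ := hσ
  obtain ⟨r, hr, hrl⟩ := hs.last
  obtain ⟨r', hr'⟩ := Finset.card_eq_one.1 (hs.card.symm.trans hc)
  have hlive : ∀ x : Fin m, σ.grp x = x → x = r := by
    intro x hx
    have h₁ : x ∈ ({r'} : Finset (Fin m)) := hr' ▸ (by simp [hx])
    have h₂ : r ∈ ({r'} : Finset (Fin m)) := hr' ▸ (by simp [hrl])
    rw [Finset.mem_singleton] at h₁ h₂
    rw [h₁, h₂]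
  have hmem : ∀ j ∈ I, j = g r ∧ q ≤ σ.acc r := by
    intro j hj
    have h := (hg j hj).2
    by_cases hgr : g r = j
    · refine ⟨hgr.symm, h.trans (le_of_eq ?_)⟩
      rw [Finset.sum_eq_single_of_mem r (by simp [hrl, hgr])]
      intro x hx hxr
      exact absurd (hlive x (by simp at hx; tauto)) hxr
    · rw [Finset.sum_eq_zero] at h
      · omega
      · intro x hx
        simp only [Finset.mem_filter, Finset.mem_univ, true_and] at hx
        exact absurd (hlive x hx.1 ▸ hx.2) hgr
  have hk := hs.one_le
  have hcard : I.card ≤ 1 := Finset.card_le_one.2 fun a ha b hb => by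
    rw [(hmem a ha).1, (hmem b hb).1]
  obtain ⟨j, hj⟩ := Finset.card_pos.1 (show 0 < I.card by omega)
  exact ⟨by omega, hr ▸ (hmem j hj).2⟩

/-- A sound configuration with a single live vertex, whose group is good enough for the last
bundle, yields a split; the last bundle gets the number `0`. -/
theorem Sound.isGood {σ : Cfg} (hs : Sound U u n q σ) (hc : σ.c = 1) (hk : σ.k = 1)
    (hq : q ≤ σ.acc σ.last) : IsGood U u n q fun x => σ.grp x - m := by
  obtain ⟨r, hr, hrl⟩ := hs.last
  obtain ⟨r', hr'⟩ := Finset.card_eq_one.1 (hs.card.symm.trans hc)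
  have hlive : ∀ x : Fin m, σ.grp x = x → x = r := by
    intro x hx
    have h₁ : x ∈ ({r'} : Finset (Fin m)) := hr' ▸ (by simp [hx])
    have h₂ : r ∈ ({r'} : Finset (Fin m)) := hr' ▸ (by simp [hrl])
    rw [Finset.mem_singleton] at h₁ h₂
    rw [h₁, h₂]
  have hn := hs.le
  have rlt := r.2
  have hlab : ∀ x : Fin m, σ.grp x = r ∨ ∃ j, 1 ≤ j ∧ j < n ∧ σ.grp x = m + j := by
    intro x
    rcases hs.label x with ⟨z, hz, hz'⟩ | ⟨j, hj, hjn, hz⟩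
    · exact .inl (by rw [hz, hlive z hz'])
    · exact .inr ⟨j, by omega, hjn, hz⟩
  have hzero : ∀ x : Fin m, σ.grp x - m = 0 ↔ σ.grp x = r := by
    intro x
    rcases hlab x with h | ⟨j, hj, hjn, hz⟩ <;> omega
  have hpos : ∀ j, j ≠ 0 → ∀ x : Fin m, σ.grp x - m = j ↔ σ.grp x = m + j := by
    intro j hj x
    rcases hlab x with h | ⟨j, hj, hjn, hz⟩ <;> omega
  refine ⟨fun x => ?_, fun j => ?_, fun j hj => ?_⟩
  · rcases hlab x with h | ⟨j, hj, hjn, hz⟩ <;> omega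
  · by_cases h : j = 0
    · subst h
      simp only [hzero]
      exact hs.linked r
    · simp only [hpos j h]
      exact hs.linked _
  · by_cases h : j = 0
    · subst h
      have := hs.acc r hrl
      simp only [weigh, hzero] at this ⊢
      rw [← this, ← hr]
      exact hq
    · have := hs.full j (by omega) hj
      simp only [weigh, hpos j h] at this ⊢
      exact this

/-! ### From integer thresholds to the maximin share -/

theorem isGood_zero (hU : U.Connected) (hn : 1 ≤ n) : IsGood U u n 0 fun _ => 0 := by
  refine ⟨fun _ => by omega, fun j => ?_, fun _ _ => Nat.zero_le _⟩
  by_cases h : j = 0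
  · subst h
    simp only [Set.ofPred_true]
    rw [← induce_preconnected_iff_linked]
    exact (SimpleGraph.induceUnivIso U).preconnected_iff.2 hU.preconnected
  · simp only [Ne.symm h, Set.ofPred_false]
    exact Linked.of_subsingleton _ Set.subsingleton_empty

theorem IsGood.le_sum {f : Fin m → ℕ} (hn : 1 ≤ n) (hf : IsGood U u n q f) : q ≤ ∑ x, u x :=
  (hf.le 0 hn).trans (Finset.sum_le_sum_of_subset (Finset.filter_subset _ _))

/-- The largest integer threshold for which a split exists, divided by the common denominator of
the utilities, is the maximin share. -/
theorem isMaximinShare_of_isGood {v : Fin m → ℝ} {D : ℕ} (hD : 0 < D)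
    (hv : ∀ x, v x = u x / D) {f : Fin m → Fin n}
    (hf : IsGood U u n q fun x => f x) (hmax : ∀ g, ¬ IsGood U u n (q + 1) g) :
    IsMaximinShare U v n ((q : ℝ) / D) ∧
      IsMaximinShareSplit U v fun i : Fin n => Finset.univ.filter fun x => f x = i := by
  have hD' : (0 : ℝ) < D := by exact_mod_cast hD
  have hval : ∀ S : Finset (Fin m), value v S = ((∑ x ∈ S, u x : ℕ) : ℝ) / D := by
    intro S
    simp only [value, hv, Nat.cast_sum, Finset.sum_div]
  have hsplit : IsSplit U fun i : Fin n => Finset.univ.filter fun x => f x = i := by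
    refine ⟨fun i => ?_, fun i j hij => ?_, fun x => ⟨f x, by simp⟩⟩
    · unfold IsBundle
      rw [induce_preconnected_iff_linked]
      simpa [Fin.val_inj] using hf.linked i
    · exact Finset.disjoint_filter.2 fun x _ h h' => hij (h.symm.trans h')
  have hle : ∀ i : Fin n, (q : ℝ) / D ≤ value v (Finset.univ.filter fun x => f x = i) := by
    intro i
    have := hf.le i i.2
    simp only [weigh, Fin.val_inj] at this
    rw [hval]
    gcongr
  have hub : ∀ P : Fin n → Finset (Fin m), IsSplit U P → ∃ i, value v (P i) ≤ (q : ℝ) / D := by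
    rintro P ⟨hb, hd, hc⟩
    by_contra! hlt
    choose g hg using hc
    have hgP : ∀ x i, x ∈ P i ↔ g x = i := fun x i =>
      ⟨fun h => by_contra fun hne => Finset.disjoint_left.1 (hd _ _ hne) (hg x) h,
        fun h => h ▸ hg x⟩
    refine hmax (fun x => g x) ⟨fun x => (g x).2, fun j => ?_, fun j hj => ?_⟩
    · by_cases hj : j < n
      · have := induce_preconnected_iff_linked.1 (hb ⟨j, hj⟩)
        convert this using 1
        ext x
        simp [hgP, Fin.ext_iff]
      · refine Linked.of_subsingleton _ fun a ha => ?_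
        have := (g a).2
        simp only [Set.mem_ofPred_eq] at ha
        omega
    · have h := hlt ⟨j, hj⟩
      rw [hval, div_lt_div_iff_of_pos_right hD'] at h
      have h' : q < ∑ x ∈ P ⟨j, hj⟩, u x := by exact_mod_cast h
      refine h'.trans_le (le_of_eq (Finset.sum_congr ?_ fun _ _ => rfl))
      ext x
      simp [hgP, Fin.ext_iff]
  have hshare : IsMaximinShare U v n ((q : ℝ) / D) := by
    refine ⟨⟨by positivity, _, hsplit, hle⟩, ?_⟩
    rintro r ⟨_, P, hP, hr⟩
    obtain ⟨i, hi⟩ := hub P hP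
    exact (hr i).trans hi
  refine ⟨hshare, hsplit, _, hshare, ?_, ?_⟩
  · obtain ⟨i, hi⟩ := hub _ hsplit
    exact ⟨i, le_antisymm hi (hle i)⟩
  · rintro _ ⟨i, rfl⟩
    exact hle i

end MMS

/-! ### The program -/

namespace RAM

/-- Test for a zero value. -/
def Expr.no (e : Expr) : Expr := .sub (.const 1) e

/-- Conjunction of tests. -/
def Expr.both (e f : Expr) : Expr := (e.no.add f.no).no

/-- Test for `e ≤ f`. -/
def Expr.le (e f : Expr) : Expr := (e.sub f).no

/-- Test for `e = f`. -/
def Expr.eq (e f : Expr) : Expr := ((e.sub f).add (f.sub e)).no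

variable {s : State} {e f : Expr}

@[simp] theorem Expr.eval_no_eq_zero : e.no.eval s = 0 ↔ e.eval s ≠ 0 := by
  simp only [no, eval]; omega

@[simp] theorem Expr.eval_both_eq_zero :
    (e.both f).eval s = 0 ↔ ¬ (e.eval s ≠ 0 ∧ f.eval s ≠ 0) := by
  simp only [both, no, eval]; omega

@[simp] theorem Expr.eval_le_eq_zero : (e.le f).eval s = 0 ↔ ¬ e.eval s ≤ f.eval s := by
  simp only [le, no, eval]; omega

@[simp] theorem Expr.eval_eq_eq_zero : (e.eq f).eval s = 0 ↔ ¬ e.eval s = f.eval s := by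
  simp only [eq, no, eval]; omega

end RAM

namespace MMS

open RAM (Expr Prog State Wp)

/-! The arrays of the program. Arrays of which only cell `0` is used are variables. -/

/- the common denominator of the utilities -/
local notation "aDen" => (2 : ℕ)
/- the integer utilities -/
local notation "aUtil" => (3 : ℕ)
/- a threshold for which a split is known -/
local notation "aLo" => (4 : ℕ)
/- a threshold for which there is no split -/
local notation "aHi" => (5 : ℕ)
/- the threshold being tried -/
local notation "aMid" => (6 : ℕ)
/- whether a split for this threshold has been found -/
local notation "aOk" => (7 : ℕ)
/- the position in the adjacency matrix of the edge that is deleted -/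
local notation "aEdge" => (8 : ℕ)
/- the five components of a configuration -/
local notation "aGrp" => (9 : ℕ)
local notation "aAcc" => (10 : ℕ)
local notation "aRem" => (11 : ℕ)
local notation "aLive" => (12 : ℕ)
local notation "aLast" => (13 : ℕ)
/- the passes over the vertices, the vertex being visited, and its candidate neighbours -/
local notation "aPass" => (14 : ℕ)
local notation "aVtx" => (15 : ℕ)
local notation "aCand" => (16 : ℕ)
/- the number of live neighbours of the vertex being visited, and one of them -/
local notation "aDeg" => (17 : ℕ)
local notation "aNbr" => (18 : ℕ)
/- the new label of a group -/
local notation "aTgt" => (19 : ℕ)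
/- a loop counter -/
local notation "aIdx" => (20 : ℕ)

namespace Code

/-- The number of goods. -/
def goods : Expr := .get 0 (.const 1)

/-- The number of bundles. -/
def bundles : Expr := .get 0 (.const 2)

/-- The numerator of the utility of a good. -/
def numer (v : Expr) : Expr := .get 0 (.add (.const 3) v)

/-- The denominator of the utility of a good. -/
def denom (v : Expr) : Expr := .get 0 (.add (.add (.const 3) goods) v)

/-- An entry of the adjacency matrix. -/
def entry (i : Expr) : Expr := .get 0 (.add (.add (.const 3) (.add goods goods)) i)

/-- The position of a pair of vertices in the adjacency matrix. -/
def position (v w : Expr) : Expr := .add (.mul v goods) w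

/-- Computes the common denominator, the integer utilities, and an upper bound for thresholds. -/
def setup : Prog :=
  .seq (.assign aDen (.const 1)) <|
  .seq (.forUpTo aIdx goods (.assign aDen (.mul (.var aDen) (denom (.var aIdx))))) <|
  .seq (.assign aHi (.const 1)) <|
  .forUpTo aIdx goods <|
    .seq (.set aUtil (.var aIdx) (.mul (.div (.var aDen) (denom (.var aIdx))) (numer (.var aIdx))))
      (.assign aHi (.add (.var aHi) (.get aUtil (.var aIdx))))

/-- Makes every vertex a group of its own. -/
def start : Prog :=
  .seq (.forUpTo aIdx goods <|
    .seq (.set aGrp (.var aIdx) (.var aIdx)) (.set aAcc (.var aIdx) (.get aUtil (.var aIdx)))) <|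
  .seq (.assign aRem bundles) <|
  .seq (.assign aLive goods) (.assign aLast (.const 0))

/-- Whether the vertices of the two loops are live and adjacent in the graph without the edge. -/
def liveAdj : Expr :=
  .both (.eq (.get aGrp (.var aVtx)) (.var aVtx)) <|
  .both (.eq (.get aGrp (.var aCand)) (.var aCand)) <|
  .both (entry (position (.var aVtx) (.var aCand))) <|
  .both (.no (.eq (position (.var aVtx) (.var aCand)) (.var aEdge)))
    (.no (.eq (position (.var aCand) (.var aVtx)) (.var aEdge)))

/-- Counts the live neighbours of a vertex, keeping one of them. -/
def countNbrs : Prog :=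
  .seq (.assign aDeg (.const 0)) <|
  .forUpTo aCand goods <| .cond liveAdj
    (.seq (.assign aDeg (.add (.var aDeg) (.const 1))) (.assign aNbr (.var aCand))) .skip

/-- Strips a leaf. -/
def stripLeaf : Prog :=
  .seq (.cond (.both (.le (.var aMid) (.get aAcc (.var aVtx))) (.le (.const 2) (.var aRem)))
    (.seq (.assign aRem (.sub (.var aRem) (.const 1))) (.assign aTgt (.add goods (.var aRem))))
    (.seq (.assign aTgt (.var aNbr)) (.set aAcc (.var aNbr)
      (.add (.get aAcc (.var aNbr)) (.get aAcc (.var aVtx)))))) <|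
  .seq (.forUpTo aIdx goods <| .cond (.eq (.get aGrp (.var aIdx)) (.var aVtx))
    (.set aGrp (.var aIdx) (.var aTgt)) .skip) <|
  .seq (.assign aLive (.sub (.var aLive) (.const 1))) (.assign aLast (.var aNbr))

/-- Strips a vertex if it is a leaf. -/
def visit : Prog := .seq countNbrs (.cond (.eq (.var aDeg) (.const 1)) stripLeaf .skip)

/-- The leaf-stripping procedure on the graph without an edge. -/
def greedy : Prog := .seq start (.forUpTo aPass goods (.forUpTo aVtx goods visit))

/-- Runs the procedure and stores the split, if it has found one. -/
def tryEdge : Prog :=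
  .seq greedy <| .cond (.both (.eq (.var aLive) (.const 1)) (.both (.eq (.var aRem) (.const 1))
      (.le (.var aMid) (.get aAcc (.var aLast)))))
    (.seq (.assign aOk (.const 1)) <| .forUpTo aIdx goods <|
      .set 1 (.add (.const 3) (.var aIdx)) (.sub (.get aGrp (.var aIdx)) goods)) .skip

/-- A step of the binary search. -/
def bisect : Prog :=
  .seq (.assign aMid (.div (.add (.var aLo) (.var aHi)) (.const 2))) <|
  .seq (.assign aOk (.const 0)) <|
  .seq (.forUpTo aEdge (.mul goods goods) tryEdge) <|
  .cond (.var aOk) (.assign aLo (.var aMid)) (.assign aHi (.var aMid))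

/-- The binary search for the largest threshold, and the output of the result. -/
def search : Prog :=
  .seq (.loop (.sub (.var aHi) (.add (.var aLo) (.const 1))) bisect) <|
  .seq (.assign 1 (.add goods (.const 2))) <|
  .seq (.set 1 (.const 1) (.var aLo)) (.set 1 (.const 2) (.var aDen))

end Code

/-! ### Correctness of the program -/

/-- The input array `a` describes the instance. -/
structure Encodes (m n : ℕ) (U : SimpleGraph (Fin m)) (num den : Fin m → ℕ) (a : ℕ → ℕ) :
    Prop where
  goods : a 1 = m
  bundles : a 2 = n
  numer : ∀ v : Fin m, a (3 + v) = num v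
  denom : ∀ v : Fin m, a (3 + m + v) = den v
  entry : ∀ v w : Fin m, a (3 + (m + m) + (v * m + w)) ≠ 0 ↔ U.Adj v w

/-- The configuration held by a memory state. -/
def cfg (s : State) : Cfg := ⟨s aGrp, s aAcc, s aRem 0, s aLive 0, s aLast 0⟩

variable {m n M : ℕ} {U : SimpleGraph (Fin m)} {num den u : Fin m → ℕ} {s : State}

open Code

theorem Encodes.eval_goods {r : State} (h : Encodes m n U num den (s 0)) (hr : r 0 = s 0) :
    Code.goods.eval r = m := by
  rw [← h.goods, ← hr]
  rfl

theorem countNbrs_spec (h : Encodes m n U num den (s 0)) (hM : m ≤ M) {v : Fin m}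
    (hv : s aVtx 0 = v) : Wp M countNbrs s fun r =>
      (r aDeg 0 = 1 → ∃ w : Fin m, r aNbr 0 = w ∧
        IsLeaf (cutEdge U (s aEdge 0)) (s aGrp) v w) ∧
      (r aDeg 0 ≠ 1 → ∀ w, ¬ IsLeaf (cutEdge U (s aEdge 0)) (s aGrp) v w) := by
  let C : Fin m → Prop := fun w =>
    s aGrp v = v ∧ s aGrp w = w ∧ (cutEdge U (s aEdge 0)).Adj v w
  refine Wp.seq (Wp.assign (Wp.forUpTo (K := m) (fun j r =>
    (r aDeg 0 = 0 ∧ ∀ w : Fin m, w < j → ¬ C w) ∨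
    (r aDeg 0 = 1 ∧ ∃ w : Fin m, w < j ∧ r aNbr 0 = w ∧ C w ∧ ∀ x : Fin m, x < j → C x → x = w) ∨
    (2 ≤ r aDeg 0 ∧ ∃ w x, w ≠ x ∧ C w ∧ C x)) hM (by decide) ?_ ?_ ?_ ?_ ?_))
  · exact fun r hr => h.eval_goods (by rw [hr 0 (by decide)]; simp)
  · intro j r x
    simp
  · left
    simp [Expr.eval]
  · intro j r hj hr hrj hI
    have e₀ : r 0 = s 0 := by rw [hr 0 (by decide)]; simp
    have eGrp : r aGrp = s aGrp := by rw [hr aGrp (by decide)]; simp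
    have eVtx : r aVtx = s aVtx := by rw [hr aVtx (by decide)]; simp
    have eEdge : r aEdge = s aEdge := by rw [hr aEdge (by decide)]; simp
    have hC : liveAdj.eval r = 0 ↔ ¬ C ⟨j, hj⟩ := by
      have hadj := h.entry v ⟨j, hj⟩
      simp only [liveAdj, Expr.eval_both_eq_zero, Expr.eval_eq_eq_zero, ne_eq, not_not,
        Expr.eval_no_eq_zero, Expr.eval_var, entry, position, Code.goods, Expr.eval, e₀, eGrp,
        eVtx, eEdge, hv, hrj, h.goods, C, cutEdge, hadj] at hadj ⊢
    have split : ∀ x : Fin m, (x : ℕ) < j + 1 ↔ (x : ℕ) < j ∨ x = ⟨j, hj⟩ := fun x => by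
      rw [Fin.ext_iff]; dsimp only; omega
    refine Wp.cond (fun hne => ?_) (fun heq => ?_)
    · have hCj : C ⟨j, hj⟩ := by_contra fun h' => hne (hC.2 h')
      refine Wp.seq (Wp.assign (Wp.assign ?_))
      simp only [Expr.eval, Expr.eval_var, ne_eq, Nat.reduceEqDiff,
        not_false_eq_true, State.write_of_ne, State.write_same, Function.update_self, hrj]
      right
      rcases hI with ⟨h₁, h₂⟩ | ⟨h₁, w, hwj, h₂, h₃, h₄⟩ | ⟨h₁, h₂⟩
      · refine .inl ⟨by omega, ⟨j, hj⟩, by simp, rfl, hCj, fun x hx hCx => ?_⟩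
        rcases (split x).1 hx with hx | hx
        · exact absurd hCx (h₂ x hx)
        · exact hx
      · exact .inr ⟨by omega, w, ⟨j, hj⟩, fun hw => by simp [hw] at hwj, h₃, hCj⟩
      · exact .inr ⟨by omega, h₂⟩
    · have hCj : ¬ C ⟨j, hj⟩ := hC.1 heq
      refine Wp.skip ?_
      rcases hI with ⟨h₁, h₂⟩ | ⟨h₁, w, hwj, h₂, h₃, h₄⟩ | ⟨h₁, h₂⟩
      · refine .inl ⟨h₁, fun x hx hCx => ?_⟩
        rcases (split x).1 hx with hx | hx
        · exact h₂ x hx hCx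
        · exact hCj (hx ▸ hCx)
      · refine .inr (.inl ⟨h₁, w, by omega, h₂, h₃, fun x hx hCx => ?_⟩)
        rcases (split x).1 hx with hx | hx
        · exact h₄ x hx hCx
        · exact absurd (hx ▸ hCx) hCj
      · exact .inr (.inr ⟨h₁, h₂⟩)
  · intro r _ hI
    rcases hI with ⟨h₁, h₂⟩ | ⟨h₁, w, hwj, h₂, h₃, h₄⟩ | ⟨h₁, w, x, hne, hw, hx⟩
    · exact ⟨by omega, fun _ w hw => h₂ w w.2 ⟨hw.1, hw.2.1, hw.2.2.1⟩⟩
    · exact ⟨fun _ => ⟨w, h₂, h₃.1, h₃.2.1, h₃.2.2, fun x hx hvx => h₄ x x.2 ⟨h₃.1, hx, hvx⟩⟩,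
        by omega⟩
    · refine ⟨by omega, fun _ y hy => hne ?_⟩
      rw [hy.2.2.2 w hw.2.1 hw.2.2, hy.2.2.2 x hx.2.1 hx.2.2]

theorem relabel_zero (g : ℕ → ℕ) (v t : ℕ) : relabel 0 g v t = g := by
  ext x
  simp [relabel]

theorem relabel_succ (j : ℕ) (g : ℕ → ℕ) (v t : ℕ) : relabel (j + 1) g v t =
    if g j = v then Function.update (relabel j g v t) j t else relabel j g v t := by
  ext x
  by_cases hx : x = j
  · subst hx
    split_ifs with h <;> simp [relabel, h]
  · have : x < j + 1 ↔ x < j := by omega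
    split_ifs with h <;> simp [relabel, hx, this]

theorem stripLeaf_spec (h : Encodes m n U num den (s 0)) (hM : m ≤ M) {v w : Fin m}
    (hv : s aVtx 0 = v) (hw : s aNbr 0 = w) :
    Wp M stripLeaf s fun r => cfg r = (cfg s).strip m (s aMid 0) v w := by
  have tail : ∀ (r : State) (σ : Cfg), (∀ a, a ∉ [aRem, aTgt, aAcc] → r a = s a) →
      relabel m (s aGrp) v (r aTgt 0) = σ.grp → r aAcc = σ.acc → r aRem 0 = σ.k →
      s aLive 0 - 1 = σ.c → w = σ.last →
      Wp M (.seq (.forUpTo aIdx goods <| .cond (.eq (.get aGrp (.var aIdx)) (.var aVtx))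
        (.set aGrp (.var aIdx) (.var aTgt)) .skip) <|
        .seq (.assign aLive (.sub (.var aLive) (.const 1))) (.assign aLast (.var aNbr))) r
      fun r => cfg r = σ := by
    rintro r ⟨grp, acc, k, c, last⟩ hr hgrp hacc hk hc hlast
    dsimp only at hgrp hacc hk hc hlast
    refine Wp.seq (Wp.forUpTo (K := m)
      (fun j r' => r' aGrp = relabel j (s aGrp) v (r aTgt 0)) hM (by decide) ?_ ?_ ?_ ?_ ?_)
    · exact fun r' hr' => h.eval_goods ((hr' 0 (by decide)).trans (hr 0 (by decide)))
    · intro j r' x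
      simp
    · rw [hr aGrp (by decide), relabel_zero]
    · intro j r' hj hr' hrj hI
      have eVtx : r' aVtx 0 = v := by rw [hr' aVtx (by decide), hr aVtx (by decide), hv]
      have eTgt : r' aTgt = r aTgt := hr' aTgt (by decide)
      have ej : r' aGrp j = s aGrp j := by simp [hI, relabel]
      refine Wp.cond (fun hne => Wp.set ?_) (fun heq => Wp.skip ?_)
      · have hj' : s aGrp j = v := by
          by_contra hj'
          exact hne (by simp [Expr.eval, hrj, ej, eVtx, hj'])
        simp only [Expr.eval_var, State.write_same]
        rw [hI, relabel_succ, if_pos hj', eTgt, hrj]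
      · have hj' : s aGrp j ≠ v := by
          intro hj'
          simp [Expr.eval, hrj, ej, eVtx, hj'] at heq
        rw [hI, relabel_succ, if_neg hj']
    · intro r' hr' hI
      refine Wp.seq (Wp.assign (Wp.assign ?_))
      have eAcc := hr' aAcc (by decide)
      have eRem := hr' aRem (by decide)
      have eLive := hr' aLive (by decide)
      have eNbr : r' aNbr 0 = w := by rw [hr' aNbr (by decide), hr aNbr (by decide), hw]
      have rLive := hr aLive (by decide)
      simp [cfg, Expr.eval, hI, hgrp, eAcc, hacc, eRem, hk, eLive, rLive, hc, eNbr, hlast]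
  refine Wp.seq (Wp.cond (fun hne => ?_) (fun heq => ?_))
  · have hq : s aMid 0 ≤ (cfg s).acc v ∧ 2 ≤ (cfg s).k := by
      simpa [Expr.eval, hv, cfg, Nat.succ_le_iff] using hne
    rw [Cfg.strip, if_pos hq]
    refine Wp.seq (Wp.assign (Wp.assign (tail _ _ (fun a ha => ?_) ?_ ?_ ?_ rfl rfl)))
    · simp only [List.mem_cons, not_or] at ha
      rw [State.write_of_ne _ _ _ (by tauto), State.write_of_ne _ _ _ (by tauto)]
    · simp [cfg, Expr.eval, goods, h.goods]
    · simp [cfg]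
    · simp [cfg, Expr.eval]
  · have hq : ¬ (s aMid 0 ≤ (cfg s).acc v ∧ 2 ≤ (cfg s).k) := by
      simpa [Expr.eval, hv, cfg, Nat.succ_le_iff] using heq
    rw [Cfg.strip, if_neg hq]
    refine Wp.seq (Wp.assign (Wp.set (tail _ _ (fun a ha => ?_) ?_ ?_ ?_ rfl rfl)))
    · simp only [List.mem_cons, not_or] at ha
      rw [State.write_of_ne _ _ _ (by tauto), State.write_of_ne _ _ _ (by tauto)]
    · simp [cfg, Expr.eval, hw]
    · simp [cfg, Expr.eval, hw, hv]
    · simp [cfg]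

theorem visit_spec (h : Encodes m n U num den (s 0)) (hM : m ≤ M) {v : Fin m}
    (hv : s aVtx 0 = v) : Wp M visit s fun r =>
      (∃ w, IsLeaf (cutEdge U (s aEdge 0)) (cfg s).grp v w ∧
        cfg r = (cfg s).strip m (s aMid 0) v w) ∨
      (∀ w, ¬ IsLeaf (cutEdge U (s aEdge 0)) (cfg s).grp v w) ∧ cfg r = cfg s := by
  refine Wp.seq ((countNbrs_spec h hM hv).mono fun r hr ⟨h₁, h₂⟩ => ?_)
  have ecfg : cfg r = cfg s := by
    simp only [cfg, hr aGrp (by decide), hr aAcc (by decide), hr aRem (by decide),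
      hr aLive (by decide), hr aLast (by decide)]
  refine Wp.cond (fun hne => ?_) (fun heq => Wp.skip ?_)
  · have hdeg : r aDeg 0 = 1 := by simpa [Expr.eval] using hne
    obtain ⟨w, hw, hleaf⟩ := h₁ hdeg
    have h' : Encodes m n U num den (r 0) := by rwa [hr 0 (by decide)]
    refine (stripLeaf_spec h' hM (by rw [hr aVtx (by decide), hv]) hw).mono fun r' _ hr' => ?_
    left
    rw [hr', ecfg, hr aMid (by decide)]
    exact ⟨w, hleaf, rfl⟩
  · have hdeg : r aDeg 0 ≠ 1 := by simpa [Expr.eval] using heq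
    exact .inr ⟨h₂ hdeg, ecfg⟩

theorem start_spec (h : Encodes m n U num den (s 0)) (hM : m ≤ M)
    (hu : ∀ x : Fin m, s aUtil x = u x) : Wp M start s fun r => (cfg r).IsStart u n := by
  refine Wp.seq (Wp.forUpTo (K := m)
    (fun j r => ∀ x < j, r aGrp x = x ∧ r aAcc x = s aUtil x) hM (by decide) ?_ ?_ ?_ ?_ ?_)
  · exact fun r hr => h.eval_goods (hr 0 (by decide))
  · intro j r x
    simp
  · simp
  · intro j r hj hr hrj hI
    refine Wp.seq (Wp.set (Wp.set ?_))
    intro x hx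
    have eUtil : r aUtil = s aUtil := hr aUtil (by decide)
    by_cases hxj : x = j
    · subst hxj
      simp [Expr.eval, hrj, eUtil]
    · simpa [Expr.eval, hrj, Function.update_of_ne hxj] using hI x (by omega)
  · intro r hr hI
    refine Wp.seq (Wp.assign (Wp.seq (Wp.assign (Wp.assign ?_))))
    have e₀ : r 0 = s 0 := hr 0 (by decide)
    refine ⟨fun x => ?_, ?_, ?_, ?_⟩
    · simpa [cfg, hu] using hI x x.2
    · simp [cfg, bundles, Expr.eval, e₀, h.bundles]
    · simp [cfg, goods, Expr.eval, e₀, h.goods]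
    · simp [cfg, Expr.eval]

theorem Cfg.strip_c (m q v w : ℕ) (σ : Cfg) : (σ.strip m q v w).c = σ.c - 1 := by
  unfold Cfg.strip
  split_ifs <;> rfl

theorem Sound.c_pos {σ : Cfg} {q : ℕ} (h : Sound U u n q σ) : 1 ≤ σ.c := by
  obtain ⟨v, _, hv⟩ := h.last
  rw [h.card]
  exact Finset.card_pos.2 ⟨v, by simp [hv]⟩

/-- The procedure yields a sound configuration; on a graph in which `n` sets can be packed, that
configuration still packs and has a single live vertex, because each pass over the vertices strips
a leaf as long as there are at least two live vertices. -/
theorem greedy_spec (h : Encodes m n U num den (s 0)) (hM : m ≤ M) (hm : 0 < m) (hn : 1 ≤ n)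
    (hu : ∀ x : Fin m, s aUtil x = u x) : Wp M greedy s fun r =>
      Sound U u n (s aMid 0) (cfg r) ∧ (Packable (cutEdge U (s aEdge 0)) u n (s aMid 0) →
        Packs (cutEdge U (s aEdge 0)) (s aMid 0) (cfg r) ∧ (cfg r).c = 1) := by
  refine Wp.seq ((start_spec h hM hu).mono fun r₁ hr₁ hs => ?_)
  have cfg_write : ∀ i, i = aPass ∨ i = aVtx → ∀ (r : State) (x : ℕ),
      cfg (r.write i 0 x) = cfg r := by
    rintro i (rfl | rfl) r x <;> simp [cfg]
  refine Wp.forUpTo (K := m) (fun j r =>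
    Sound U u n (s aMid 0) (cfg r) ∧ (Packable (cutEdge U (s aEdge 0)) u n (s aMid 0) →
      Packs (cutEdge U (s aEdge 0)) (s aMid 0) (cfg r) ∧
        ((cfg r).c ≤ 1 ∨ (cfg r).c + j ≤ m))) hM (by decide) ?_ ?_ ?_ ?_ ?_
  · exact fun r hr => h.eval_goods ((hr 0 (by decide)).trans (hr₁ 0 (by decide)))
  · intro j r x
    simp [cfg_write]
  · exact ⟨hs.sound hn hm, fun hp => ⟨hs.packs hp, .inr hs.2.2.1.le⟩⟩
  · rintro j r hj hr - ⟨hI, hI'⟩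
    refine Wp.forUpTo (K := m) (fun i r' =>
      Sound U u n (s aMid 0) (cfg r') ∧ (Packable (cutEdge U (s aEdge 0)) u n (s aMid 0) →
        Packs (cutEdge U (s aEdge 0)) (s aMid 0) (cfg r')) ∧
      ((cfg r').c + 1 ≤ (cfg r).c ∨ cfg r' = cfg r ∧ ∀ v : Fin m, v < i →
        ∀ w, ¬ IsLeaf (cutEdge U (s aEdge 0)) (cfg r).grp v w)) hM (by decide) ?_ ?_ ?_ ?_ ?_
    · exact fun r' hr' => h.eval_goods
        ((hr' 0 (by decide)).trans ((hr 0 (by decide)).trans (hr₁ 0 (by decide))))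
    · intro j r x
      simp [cfg_write]
    · exact ⟨hI, fun hp => (hI' hp).1, .inr ⟨rfl, by simp⟩⟩
    · rintro i r' hi hr' hri ⟨hS, hP, hc⟩
      have e : ∀ a, a ∉ (aPass :: (aVtx :: visit.mods)) ++ start.mods → r' a = s a := by
        intro a ha
        simp only [List.mem_append, List.mem_cons, not_or] at ha
        rw [hr' a (by simp; tauto), hr a _, hr₁ a ha.2]
        simp only [Prog.forUpTo, Prog.assign, Prog.mods, List.mem_cons, List.mem_append]
        simp; tauto
      have h' : Encodes m n U num den (r' 0) := by rwa [e 0 (by decide)]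
      refine (visit_spec h' hM (v := ⟨i, hi⟩) hri).mono fun r'' _ hvis => ?_
      rw [e aEdge (by decide), e aMid (by decide)] at hvis
      rcases hvis with ⟨w, hw, hcfg⟩ | ⟨hno, hcfg⟩
      · rw [hcfg]
        refine ⟨hS.strip (cutEdge_le _) hw, fun hp => (hP hp).strip hw, .inl ?_⟩
        rw [Cfg.strip_c]
        have := hS.c_pos
        rcases hc with hc | ⟨hc, -⟩
        · omega
        · rw [hc] at this ⊢; omega
      · rw [hcfg]
        refine ⟨hS, hP, hc.imp_right fun hc => ⟨hc.1, fun x hx w => ?_⟩⟩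
        by_cases hxi : (x : ℕ) = i
        · obtain rfl : x = ⟨i, hi⟩ := Fin.ext hxi
          rw [← hc.1]
          exact hno w
        · exact hc.2 x (by omega) w
    · rintro r' - ⟨hS, hP, hc⟩
      refine ⟨hS, fun hp => ⟨hP hp, ?_⟩⟩
      rcases hc with hc | ⟨hc, hno⟩
      · have := (hI' hp).2
        omega
      · rw [hc]
        left
        by_contra! h2
        obtain ⟨v, w, hvw⟩ := exists_isLeaf hp.2.1 (hI' hp).1.1 (hI.card ▸ h2)
        exact hno v v.2 w hvw
  · rintro r - ⟨hS, hP⟩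
    refine ⟨hS, fun hp => ⟨(hP hp).1, ?_⟩⟩
    have := hS.c_pos
    have := (hP hp).2
    omega

theorem tryEdge_spec (h : Encodes m n U num den (s 0)) (hM : m ≤ M) (hm : 0 < m) (hn : 1 ≤ n)
    (hu : ∀ x : Fin m, s aUtil x = u x) (hq : 1 ≤ s aMid 0) : Wp M tryEdge s fun r =>
      r aOk 0 = 1 ∧ IsGood U u n (s aMid 0) (fun x => r 1 (3 + x)) ∨
      ¬ Packable (cutEdge U (s aEdge 0)) u n (s aMid 0) ∧ r aOk = s aOk ∧ r 1 = s 1 := by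
  refine Wp.seq ((greedy_spec h hM hm hn hu).mono fun r hr ⟨hS, hP⟩ => Wp.cond ?_ ?_)
  · intro hne
    have eMid : r aMid = s aMid := hr aMid (by decide)
    obtain ⟨hc, hk, hacc⟩ : (cfg r).c = 1 ∧ (cfg r).k = 1 ∧
        s aMid 0 ≤ (cfg r).acc (cfg r).last := by
      simpa [Expr.eval, cfg, eMid] using hne
    refine Wp.seq (Wp.assign (Wp.forUpTo (K := m)
      (fun j r' => ∀ x < j, r' 1 (3 + x) = r aGrp x - m) hM (by decide) ?_ ?_ ?_ ?_ ?_))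
    · exact fun r' hr' => h.eval_goods (by rw [hr' 0 (by decide)]; simpa using hr 0 (by decide))
    · intro j r' x
      simp
    · simp
    · intro j r' hj hr' hrj hI
      refine Wp.set fun x hx => ?_
      have eGrp : r' aGrp = r aGrp := by rw [hr' aGrp (by decide)]; simp
      have eGoods : goods.eval r' = m :=
        h.eval_goods (by rw [hr' 0 (by decide)]; simpa using hr 0 (by decide))
      by_cases hxj : x = j
      · subst hxj
        simp [Expr.eval, hrj, eGrp, eGoods]
      · simpa [Expr.eval, hrj, hxj] using hI x (by omega)
    · intro r' hr' hI
      left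
      refine ⟨by rw [hr' aOk (by decide)]; simp [Expr.eval], ?_⟩
      have : (fun x : Fin m => r' 1 (3 + x)) = fun x : Fin m => (cfg r).grp x - m := by
        ext x
        exact hI x x.2
      rw [this]
      exact hS.isGood hc hk hacc
  · intro heq
    refine Wp.skip (.inr ⟨fun hp => ?_, hr aOk (by decide), hr 1 (by decide)⟩)
    obtain ⟨hpacks, hc⟩ := hP hp
    obtain ⟨hk, hacc⟩ := hpacks.final hS hq hc
    have eMid : r aMid = s aMid := hr aMid (by decide)
    have : (cfg r).c = 1 ∧ (cfg r).k = 1 ∧ s aMid 0 ≤ (cfg r).acc (cfg r).last := ⟨hc, hk, hacc⟩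
    simp [Expr.eval] at heq
    simp only [cfg] at this
    rw [eMid] at heq
    exact absurd this.2.2 (not_le.2 (heq this.1 this.2.1))

/-- The invariant of the binary search: the output array holds a split for the lower threshold, and
there is none for the upper one. -/
structure Searching (U : SimpleGraph (Fin m)) (u : Fin m → ℕ) (n : ℕ) (s : State) : Prop where
  lt : s aLo 0 < s aHi 0
  good : IsGood U u n (s aLo 0) fun x => s 1 (3 + x)
  not_good : ∀ f, ¬ IsGood U u n (s aHi 0) f

theorem bisect_spec (hU : IsUnicyclic U) (h : Encodes m n U num den (s 0)) (hM : m * m ≤ M)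
    (hm : 0 < m) (hn : 1 ≤ n) (hu : ∀ x : Fin m, s aUtil x = u x) (hs : Searching U u n s)
    (hlt : s aLo 0 + 1 < s aHi 0) : Wp M bisect s fun r => Searching U u n r ∧
      (r aLo 0 = s aLo 0 ∧ r aHi 0 = (s aLo 0 + s aHi 0) / 2 ∨
        r aLo 0 = (s aLo 0 + s aHi 0) / 2 ∧ r aHi 0 = s aHi 0) := by
  have hM' : m ≤ M := (Nat.le_mul_of_pos_left m hm).trans hM
  refine Wp.seq (Wp.assign (Wp.seq (Wp.assign ?_)))
  generalize hs' : ((s.write aMid 0 _).write aOk 0 _) = s'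
  have e : ∀ a, a ≠ aMid → a ≠ aOk → s' a = s a := by
    intro a h₁ h₂
    rw [← hs', State.write_of_ne _ _ _ h₂, State.write_of_ne _ _ _ h₁]
  have eMid : s' aMid 0 = (s aLo 0 + s aHi 0) / 2 := by
    rw [← hs']
    simp [Expr.eval]
  have eOk : s' aOk 0 = 0 := by
    rw [← hs']
    simp [Expr.eval]
  refine Wp.seq (Wp.forUpTo (K := m * m) (fun j r =>
    r aOk 0 = 1 ∧ IsGood U u n (s' aMid 0) (fun x => r 1 (3 + x)) ∨
    r aOk 0 = 0 ∧ r 1 = s' 1 ∧ ∀ i < j, ¬ Packable (cutEdge U i) u n (s' aMid 0))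
    hM (by decide) ?_ ?_ ?_ ?_ ?_)
  · intro r hr
    have := h.eval_goods (r := r) ((hr 0 (by decide)).trans (e 0 (by decide) (by decide)))
    simp only [Expr.eval, this]
  · intro j r x
    simp
  · exact .inr ⟨eOk, rfl, by simp⟩
  · intro j r hj hr hrj hI
    have e₀ : r 0 = s 0 := (hr 0 (by decide)).trans (e 0 (by decide) (by decide))
    have eUtil : r aUtil = s aUtil :=
      (hr aUtil (by decide)).trans (e aUtil (by decide) (by decide))
    have eMid' : r aMid = s' aMid := hr aMid (by decide)
    refine (tryEdge_spec (by rwa [e₀]) hM' hm hn (by rwa [eUtil])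
      (by rw [eMid', eMid]; omega)).mono fun r' _ hr' => ?_
    rw [eMid', hrj] at hr'
    rcases hr' with hr' | ⟨hno, hok, hout⟩
    · exact .inl hr'
    · rw [hok, hout]
      refine hI.imp_right fun ⟨h₁, h₂, h₃⟩ => ⟨h₁, h₂, fun i hi => ?_⟩
      rcases Nat.lt_succ_iff_lt_or_eq.1 hi with hi | rfl
      · exact h₃ i hi
      · exact hno
  · intro r hr hI
    have eLo : r aLo = s aLo := (hr aLo (by decide)).trans (e aLo (by decide) (by decide))
    have eHi : r aHi = s aHi := (hr aHi (by decide)).trans (e aHi (by decide) (by decide))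
    have eMid' : r aMid = s' aMid := hr aMid (by decide)
    refine Wp.cond (fun hne => Wp.assign ?_) (fun heq => Wp.assign ?_)
    · rcases hI with ⟨-, hgood⟩ | ⟨h₀, -⟩
      swap
      · exact absurd h₀ hne
      refine ⟨⟨?_, ?_, ?_⟩, .inr ?_⟩
      · simp [eMid', eMid, eHi]; omega
      · simpa [eMid'] using hgood
      · simpa [eHi] using hs.not_good
      · simp [eMid', eMid, eHi]
    · rcases hI with ⟨h₁, -⟩ | ⟨-, hout, hno⟩
      · simp [h₁] at heq
      refine ⟨⟨?_, ?_, fun f hf => ?_⟩, .inl ?_⟩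
      · simp [eMid', eMid, eLo]; omega
      · simpa [eLo, hout, e 1 (by decide) (by decide)] using hs.good
      · simp only [State.write_same, Function.update_self, Expr.eval_var, eMid'] at hf
        obtain ⟨i, hi, hp⟩ := hf.exists_packable hU
        exact hno i hi hp
      · simp [eMid', eMid, eLo]

theorem search_spec (hU : IsUnicyclic U) (h : Encodes m n U num den (s 0)) (hM : m * m ≤ M)
    (hm : 0 < m) (hn : 1 ≤ n) (hu : ∀ x : Fin m, s aUtil x = u x) (hs : Searching U u n s)
    (hM' : Nat.size (s aHi 0) ≤ M) : Wp M search s fun r =>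
      r 1 0 = m + 2 ∧ r 1 2 = s aDen 0 ∧ IsGood U u n (r 1 1) (fun x => r 1 (3 + x)) ∧
        ∀ f, ¬ IsGood U u n (r 1 1 + 1) f := by
  refine Wp.seq (Wp.loop (J := Nat.size (s aHi 0)) (fun j r =>
    (∀ a, a ∉ bisect.mods → r a = s a) ∧ Searching U u n r ∧ r aHi 0 - r aLo 0 ≤ 2 ^ j) hM'
    ⟨fun _ _ => rfl, hs, ?_⟩ ?_ ?_)
  · have := Nat.lt_size_self (s aHi 0)
    omega
  · rintro j r ⟨hr, hS, hj⟩ hne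
    have hlt : r aLo 0 + 1 < r aHi 0 := by
      simp only [Expr.eval, Expr.eval_var] at hne
      omega
    obtain ⟨j, rfl⟩ : ∃ i, j = i + 1 := by
      refine Nat.exists_eq_succ_of_ne_zero ?_
      rintro rfl
      omega
    refine ⟨j, rfl, (bisect_spec hU (by rwa [hr 0 (by decide)]) hM hm hn
      (by rwa [hr aUtil (by decide)]) hS hlt).mono fun r' hr' ⟨hS', hb⟩ =>
      ⟨fun a ha => (hr' a ha).trans (hr a ha), hS', ?_⟩⟩
    rw [pow_succ] at hj
    omega
  · rintro j r ⟨hr, hS, -⟩ heq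
    have hlt := hS.lt
    have hhi : r aHi 0 = r aLo 0 + 1 := by
      simp only [Expr.eval, Expr.eval_var] at heq
      omega
    have eGoods : r 0 1 = m := by rw [hr 0 (by decide), h.goods]
    have eDen : r aDen = s aDen := hr aDen (by decide)
    refine Wp.seq (Wp.assign (Wp.seq (Wp.set (Wp.set ⟨?_, ?_, ?_, ?_⟩))))
    · simp [Expr.eval, goods, eGoods]
    · simp [Expr.eval, eDen]
    · have h₁ : ∀ x : ℕ, 3 + x ≠ 2 := by omega
      have h₂ : ∀ x : ℕ, 3 + x ≠ 1 := by omega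
      simpa [Expr.eval, Function.update_apply, h₁, h₂] using hS.good
    · simpa [Expr.eval, hhi] using hS.not_good

theorem setup_spec (h : Encodes m n U num den (s 0)) (hM : m ≤ M) : Wp M setup s fun r =>
    r aDen 0 = ∏ x, den x ∧ (∀ x : Fin m, r aUtil x = (∏ x, den x) / den x * num x) ∧
      r aHi 0 = 1 + ∑ x, (∏ x, den x) / den x * num x := by
  -- The data as functions on the natural numbers, for sums and products over `Finset.range`.
  let den' : ℕ → ℕ := fun j => s 0 (3 + m + j)
  let num' : ℕ → ℕ := fun j => s 0 (3 + j)
  have hprod : ∏ j ∈ Finset.range m, den' j = ∏ x, den x := by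
    rw [Finset.prod_range]
    exact Finset.prod_congr rfl fun x _ => h.denom x
  refine Wp.seq (Wp.assign (Wp.seq (Wp.forUpTo (K := m)
    (fun j r => r aDen 0 = ∏ i ∈ Finset.range j, den' i) hM (by decide) ?_ ?_ ?_ ?_ ?_)))
  · exact fun r hr => h.eval_goods (by rw [hr 0 (by decide)]; simp)
  · intro j r x
    simp
  · simp [Expr.eval]
  · intro j r hj hr hrj hI
    refine Wp.assign ?_
    have e₀ : r 0 = s 0 := by rw [hr 0 (by decide)]; simp
    simp [Expr.eval, denom, goods, hrj, e₀, h.goods, hI, Finset.prod_range_succ, den']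
  · intro r hr hD
    rw [hprod] at hD
    refine Wp.seq (Wp.assign (Wp.forUpTo (K := m) (fun j r' =>
      (∀ x < j, r' aUtil x = (∏ x, den x) / den' x * num' x) ∧
      r' aHi 0 = 1 + ∑ x ∈ Finset.range j, (∏ x, den x) / den' x * num' x) hM (by decide)
      ?_ ?_ ?_ ?_ ?_))
    · exact fun r' hr' => h.eval_goods (by
        rw [hr' 0 (by decide), State.write_of_ne _ _ _ (by decide), hr 0 (by decide)]; simp)
    · intro j r x
      simp
    · simp [Expr.eval]
    · intro j r' hj hr' hrj ⟨hI, hI'⟩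
      have e₀ : r' 0 = s 0 := by
        rw [hr' 0 (by decide), State.write_of_ne _ _ _ (by decide), hr 0 (by decide)]; simp
      have eDen : r' aDen 0 = ∏ x, den x := by
        rw [hr' aDen (by decide), State.write_of_ne _ _ _ (by decide), hD]
      refine Wp.seq (Wp.set (Wp.assign ⟨fun x hx => ?_, ?_⟩))
      · by_cases hxj : x = j
        · subst hxj
          simp [Expr.eval, denom, numer, goods, hrj, e₀, eDen, h.goods, den', num']
        · simpa [Expr.eval, hrj, hxj] using hI x (by omega)
      · simp [Expr.eval, denom, numer, goods, hrj, e₀, eDen, h.goods, den', num', hI',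
          Finset.sum_range_succ, add_assoc]
    · intro r' hr' ⟨hI, hI'⟩
      refine ⟨?_, fun x => ?_, ?_⟩
      · rw [hr' aDen (by decide), State.write_of_ne _ _ _ (by decide), hD]
      · rw [hI x x.2]
        simp only [den', num', h.denom, h.numer]
      · rw [hI', Finset.sum_range]
        simp only [den', num', h.denom, h.numer]

end MMS

/-! ### The input, the output and the running time -/

namespace RAM

theorem length_le_inputSize (l : List ℕ) : l.length ≤ inputSize l := by
  induction l with
  | nil => simp
  | cons x l ih => simp only [inputSize, List.map_cons, List.sum_cons, List.length_cons] at *; omega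

theorem size_le_inputSize {l : List ℕ} {x : ℕ} (h : x ∈ l) : Nat.size x ≤ inputSize l := by
  have := List.single_le_sum (l := l.map fun x => 1 + Nat.size x) (fun _ _ => Nat.zero_le _)
    (1 + Nat.size x) (List.mem_map.2 ⟨x, h, rfl⟩)
  simp only [inputSize]
  omega

theorem size_input_le (l : List ℕ) (a i : ℕ) : Nat.size (input l a i) ≤ inputSize l := by
  unfold input
  split_ifs
  · cases i with
    | zero =>
      refine le_trans ?_ (length_le_inputSize l)
      rw [List.getD_cons_zero, Nat.size_le]
      exact Nat.lt_two_pow_self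
    | succ i =>
      rw [List.getD_cons_succ]
      by_cases hi : i < l.length
      · rw [List.getD_eq_getElem _ _ hi]
        exact size_le_inputSize (List.getElem_mem hi)
      · rw [List.getD_eq_default _ _ (not_lt.1 hi)]
        simp
  · simp

end RAM

namespace MMS

open RAM (Expr Prog State Wp)

theorem getElem?_flatMap_mul_add {α β : Type*} (l : List α) {f : α → List β} {m : ℕ}
    (hf : ∀ x, (f x).length = m) (i : ℕ) {j : ℕ} (hj : j < m) :
    (l.flatMap f)[i * m + j]? = l[i]?.bind fun x => (f x)[j]? := by
  induction l generalizing i with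
  | nil => simp
  | cons x l ih =>
    rw [List.flatMap_cons]
    cases i with
    | zero => rw [zero_mul, zero_add, List.getElem?_append_left (by rw [hf]; exact hj)]; simp
    | succ i =>
      rw [List.getElem?_append_right (by rw [hf]; nlinarith), hf,
        show (i + 1) * m + j - m = i * m + j by rw [add_mul]; omega, ih]
      simp

variable {m n : ℕ} {U : SimpleGraph (Fin m)} {num den : Fin m → ℕ}

theorem encodes_input (m n : ℕ) (U : SimpleGraph (Fin m)) (num den : Fin m → ℕ) :
    Encodes m n U num den (RAM.input (encode m n U num den) 0) := by
  classical
  have hin : ∀ i, RAM.input (encode m n U num den) 0 (3 + i) =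
      ((List.ofFn num ++ List.ofFn den ++ (List.finRange m).flatMap fun v =>
        (List.finRange m).map fun w => if U.Adj v w then 1 else 0)[i]?).getD 0 := by
    intro i
    rw [RAM.input, if_pos rfl, List.getD_eq_getElem?_getD, add_comm 3 i]
    simp only [encode, List.getElem?_cons_succ]
  constructor
  · rfl
  · rfl
  · intro v
    rw [hin, List.append_assoc, List.getElem?_append_left (by simp)]
    simp
  · intro v
    rw [add_assoc, hin, List.append_assoc, List.getElem?_append_right (by simp),
      List.getElem?_append_left (by simp)]
    simp
  · intro v w
    rw [add_assoc, hin, List.getElem?_append_right (by simp)]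
    simp only [List.length_append, List.length_ofFn, Nat.add_sub_cancel_left]
    rw [getElem?_flatMap_mul_add _ (by simp) _ w.2]
    simp

theorem goods_le_inputSize : m ≤ RAM.inputSize (encode m n U num den) := by
  refine le_trans ?_ (RAM.length_le_inputSize _)
  simp only [encode, List.length_cons, List.length_append, List.length_ofFn]
  omega

/-- The algorithm: binary search over integer thresholds, after clearing denominators. -/
def algorithm : Prog := .seq Code.setup Code.search

open Polynomial in
/-- A bound, in terms of the size of the input, for the numbers of iterations of the loops of the
binary search. -/
noncomputable def iterBound (W : ℕ) : ℕ[X] :=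
  X * X + (X + Code.setup.stepBound * (C W * (X + 1)))

open Polynomial in
/-- A bound for the number of steps of the algorithm. -/
noncomputable def totalSteps (W : ℕ) : ℕ[X] :=
  Code.setup.stepBound + Code.search.stepBound.comp (iterBound W)

open Polynomial in
/-- A bound for the cost of the algorithm. -/
noncomputable def totalCost (W : ℕ) : ℕ[X] :=
  totalSteps W * (C W * (1 + (X + totalSteps W * (C W * (X + 1)))))

/-- The algorithm, run on an instance, halts in polynomial time with the best threshold, the common
denominator and a split for this threshold in the output array. -/
theorem algorithm_spec (hU : IsUnicyclic U) (hn : 1 ≤ n) :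
    ∃ (t : ℕ) (s : State),
      RAM.Exec algorithm (RAM.input (encode m n U num den)) t s ∧
      t ≤ (totalCost algorithm.weight).eval
        (RAM.inputSize (encode m n U num den)) ∧
      s 1 0 = m + 2 ∧ s 1 2 = ∏ x, den x ∧
      IsGood U (fun x => (∏ x, den x) / den x * num x) n (s 1 1) (fun x => s 1 (3 + x)) ∧
      ∀ f, ¬ IsGood U (fun x => (∏ x, den x) / den x * num x) n (s 1 1 + 1) f := by
  have hm : 0 < m := by
    have := hU.1.nonempty
    exact Fin.pos_iff_nonempty.2 this
  have hE := encodes_input m n U num den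
  have hmS := goods_le_inputSize (n := n) (U := U) (num := num) (den := den)
  have hsize := RAM.size_input_le (encode m n U num den)
  set s₀ := RAM.input (encode m n U num den) with hs₀
  set S := RAM.inputSize (encode m n U num den)
  set W := algorithm.weight with hW
  obtain ⟨r, n₁, hn₁, hrun₁, hD, hu, hhi⟩ := setup_spec hE hmS
  have hfr := hrun₁.frame
  have hW₁ : Code.setup.weight ≤ W := Nat.le_add_right _ _
  have hgrow := ((hrun₁.exec (by decide) hW₁ (hsize 0)).2 S hsize).1
  have hsearch : Searching U (fun x => (∏ x, den x) / den x * num x) n r := by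
    have hlo : r 4 0 = 0 := by rw [hfr 4 (by decide), hs₀]; simp [RAM.input]
    have hout : r 1 = fun _ => 0 := by
      rw [hfr 1 (by decide), hs₀]; ext; simp [RAM.input]
    refine ⟨by rw [hlo, hhi]; omega, ?_, fun f hf => ?_⟩
    · rw [hlo, hout]
      exact isGood_zero hU.1 hn
    · have := hf.le_sum hn
      rw [hhi] at this
      omega
  have hM : (iterBound W).eval S =
      S * S + (S + Code.setup.stepBound.eval S * (W * (S + 1))) := by
    simp [iterBound]
  obtain ⟨s, n₂, hn₂, hrun₂, h₁, h₂, h₃, h₄⟩ :=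
    search_spec (M := (iterBound W).eval S) hU (by rwa [hfr 0 (by decide)])
      (by rw [hM]; have := Nat.mul_le_mul hmS hmS; omega) hm hn hu hsearch (by
        have h := hgrow 5 0
        have h' : n₁ * (W * (S + 1)) ≤ Code.setup.stepBound.eval S * (W * (S + 1)) :=
          Nat.mul_le_mul_right _ hn₁
        rw [hM]
        omega)
  have hrun := RAM.Steps.seq hrun₁ hrun₂
  obtain ⟨t, hexec, ht⟩ := ((hrun.exec (by decide) hW.ge (hsize 0)).2 S hsize).2 _ le_rfl
  refine ⟨t, s, hexec, ht.trans ?_, h₁, h₂.trans hD, h₃, h₄⟩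
  have hN : n₁ + n₂ ≤ (totalSteps W).eval S := by
    simp only [totalSteps, Polynomial.eval_add, Polynomial.eval_comp]
    omega
  simp only [totalCost, Polynomial.eval_mul, Polynomial.eval_add, Polynomial.eval_C,
    Polynomial.eval_X, Polynomial.eval_one]
  gcongr

theorem output_eq {s : State} (h : s 1 0 = m + 2) :
    RAM.output s = s 1 1 :: s 1 2 :: List.ofFn fun v : Fin m => s 1 (3 + v) := by
  rw [RAM.output, h, List.range_succ_eq_map, List.range_succ_eq_map]
  simp only [List.map_cons, List.map_map, List.cons.injEq, true_and]
  refine List.ext_getElem (by simp) fun i _ _ => ?_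
  simp only [List.getElem_map, List.getElem_range, List.getElem_ofFn, Function.comp_apply]
  congr 1
  omega

end MMS

theorem mainTheorem9 :
    ∃ (A : RAM.Prog) (p : Polynomial ℕ),
      ∀ (m n : ℕ) (U : SimpleGraph (Fin m)) (num den : Fin m → ℕ),
        MMS.IsUnicyclic U → 1 ≤ n → (∀ v, 0 < den v) →
        ∃ (t : ℕ) (s : RAM.State),
          RAM.Exec A (RAM.input (MMS.encode m n U num den)) t s ∧
          t ≤ p.eval (RAM.inputSize (MMS.encode m n U num den)) ∧
          ∃ (a b : ℕ) (f : Fin m → Fin n),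
            RAM.output s = a :: b :: List.ofFn (fun v => (f v : ℕ)) ∧
            0 < b ∧
            MMS.IsMaximinShare U (fun v => (num v : ℝ) / (den v : ℝ)) n ((a : ℝ) / (b : ℝ)) ∧
            MMS.IsMaximinShareSplit U (fun v => (num v : ℝ) / (den v : ℝ))
              (fun i : Fin n => Finset.univ.filter fun v => f v = i) := by
  refine ⟨MMS.algorithm, MMS.totalCost MMS.algorithm.weight, fun m n U num den hU hn hden => ?_⟩
  obtain ⟨t, s, hexec, ht, hlen, hD, hgood, hmax⟩ :=
    MMS.algorithm_spec (num := num) (den := den) hU hn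
  have hpos : 0 < ∏ x, den x := Finset.prod_pos fun x _ => hden x
  refine ⟨t, s, hexec, ht, s 1 1, s 1 2, fun v => ⟨s 1 (3 + v), hgood.lt v⟩,
    MMS.output_eq hlen, hD ▸ hpos, ?_⟩
  rw [hD]
  refine MMS.isMaximinShare_of_isGood hpos (fun x => ?_) hgood hmax
  have hdvd : den x ∣ ∏ x, den x := Finset.dvd_prod_of_mem den (Finset.mem_univ x)
  have h₁ : (den x : ℝ) ≠ 0 := by exact_mod_cast (hden x).ne'
  have h₂ : ((∏ x, den x : ℕ) : ℝ) ≠ 0 := by exact_mod_cast hpos.ne'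
  rw [Nat.cast_mul, Nat.cast_div hdvd h₁]
  field_simp
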